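/- Let $k$ be a field and let $S=\bigoplus_{i\ge 0}S_i$ be a standard graded commutative $k$-algebra: $S_0=k$, and $S$ is generated as a $k$-algebra by the finite-dimensional space $S_1$. Let $\mathfrak m=\bigoplus_{i>0}S_i$, and assume that $S$ is Koszul, i.e. in the minimal graded free resolution of $k=S/\mathfrak m$ over $S$ the $i$-th term is generated in degree $i$ for every $i$. Let $M$ be a finitely generated $\mathbb Z$-graded $S$-module with a minimal graded free resolution $(F,\partial)\to M$ (each $F_n$ of finite rank). For a graded $S$-module $N$ let $N_{\langle d\rangle}$ (resp. $N_{\langle\le d\rangle}$) be the $S$-submodule generated by the elements of $N$ of degree $d$ (resp. of degree at most $d$). Say that $M$ is *componentwise linear in the first $p$ steps* if for every $d\in\mathbb Z$ the minimal graded free resolution $G$ of $M_{\langle d\rangle}$ has $G_i$ generated in degree $i+d$ for all $i<p$. Put $\operatorname{gr}(M)=\bigoplus_{d}M_{\langle\le d\rangle}/M_{\langle\le d-1\rangle}$ (up to re-indexing, the associated graded module of the $\mathfrak m$-adic filtration of $M$). Let $\operatorname{lin}(F)=\bigoplus_d F_{\langle d\rangle}$ be the linear part of $F$, where $(F_{\langle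 d\rangle})_n=(F_n)_{\langle\le d+n\rangle}/(F_n)_{\langle\le d+n-1\rangle}$ with the differential induced by $\partial$. The augmentation $F_0\to M$ induces a natural map $H_0(\operatorname{lin}(F))\to\operatorname{gr}(M)$. Let $r>0$ be an integer. Then $M$ is componentwise linear in the first $r+1$ steps if and only if $H_n(\operatorname{lin}(F))=0$ for all $0<n<r$ and the natural map $H_0(\operatorname{lin}(F))\to\operatorname{gr}(M)$ is an isomorphism. -/

import Mathlib

open scoped DirectSum

noncomputable section

namespace GradedLin

universe u v w

section Basics

variable {k : Type u} [Field k] {S : Type v} [CommRing S] [Algebra k S]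

/-- A commutative graded `k`-algebra `S = ⨁ 𝒜 i` is standard graded: `S₀ = k`, and `S` is generated
as a `k`-algebra by the finite-dimensional space `S₁`. -/
structure IsStandardGraded (𝒜 : ℕ → Submodule k S) [GradedAlgebra 𝒜] : Prop where
  nontrivial : Nontrivial S
  degree_zero : 𝒜 0 = 1
  finite_degree_one : FiniteDimensional k (𝒜 1)
  adjoin_degree_one : Algebra.adjoin k (𝒜 1 : Set S) = ⊤

/-- The maximal graded ideal `𝔪` of `S`, spanned by the elements of positive degree. -/
def maxIdeal (𝒜 : ℕ → Submodule k S) [GradedAlgebra 𝒜] : Ideal S :=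
  (HomogeneousIdeal.irrelevant 𝒜).toIdeal

/-- The degree `z` part of `S` for an integer `z`; it is zero for negative `z`. -/
def intDegree (𝒜 : ℕ → Submodule k S) (z : ℤ) : Submodule k S :=
  if 0 ≤ z then 𝒜 z.toNat else ⊥

/-- The family `ℳ` of additive subgroups is a `ℤ`-grading making `M` a graded `S`-module. -/
structure IsGradedModule (𝒜 : ℕ → Submodule k S) {M : Type w} [AddCommGroup M] [Module S M]
    (ℳ : ℤ → AddSubgroup M) : Prop where
  isInternal : DirectSum.IsInternal ℳ
  smul_mem : ∀ (i : ℕ) (j : ℤ) (s : S) (x : M), s ∈ 𝒜 i → x ∈ ℳ j → s • x ∈ ℳ ((i : ℤ) + j)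

/-- The grading of the free module `⨁ₗ S(-aₗ)`, whose `l`-th basis vector has degree `aₗ`. -/
def freeGrading (𝒜 : ℕ → Submodule k S) {b : ℕ} (a : Fin b → ℤ) (e : ℤ) :
    AddSubgroup (Fin b → S) where
  carrier := {x | ∀ l, x l ∈ intDegree 𝒜 (e - a l)}
  zero_mem' := fun _ => Submodule.zero_mem _
  add_mem' := fun hx hy l => Submodule.add_mem _ (hx l) (hy l)
  neg_mem' := fun hx l => Submodule.neg_mem _ (hx l)

/-- The grading of the residue field `k = S/𝔪`, concentrated in degree `0`. -/
def residueGrading (𝒜 : ℕ → Submodule k S) [GradedAlgebra 𝒜] (e : ℤ) :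
    AddSubgroup (S ⧸ maxIdeal 𝒜) :=
  if e = 0 then ⊤ else ⊥

end Basics

section Filtration

variable {S : Type v} [CommRing S] {M : Type w} [AddCommGroup M] [Module S M]

/-- `M_⟨d⟩`, the `S`-submodule generated by the degree `d` part of `M`. -/
def genAt (S : Type v) [CommRing S] {M : Type w} [AddCommGroup M] [Module S M]
    (ℳ : ℤ → AddSubgroup M) (d : ℤ) : Submodule S M :=
  Submodule.span S (ℳ d : Set M)

/-- `M_⟨≤d⟩`, the `S`-submodule generated by the parts of `M` of degree at most `d`. -/
def genLE (S : Type v) [CommRing S] {M : Type w} [AddCommGroup M] [Module S M]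
    (ℳ : ℤ → AddSubgroup M) (d : ℤ) : Submodule S M :=
  Submodule.span S {x | ∃ e ≤ d, x ∈ ℳ e}

/-- The grading that a submodule inherits from `M`. -/
def subGrading (ℳ : ℤ → AddSubgroup M) (N : Submodule S M) (e : ℤ) : AddSubgroup N :=
  (ℳ e).comap N.subtype.toAddMonoidHom

/-- The subquotient `M_⟨≤d⟩ / M_⟨≤d-1⟩`. -/
def Piece (S : Type v) [CommRing S] {M : Type w} [AddCommGroup M] [Module S M]
    (ℳ : ℤ → AddSubgroup M) (d : ℤ) : Type w :=
  genLE S ℳ d ⧸ (genLE S ℳ (d - 1)).submoduleOf (genLE S ℳ d)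

instance (ℳ : ℤ → AddSubgroup M) (d : ℤ) : AddCommGroup (Piece S ℳ d) :=
  inferInstanceAs
    (AddCommGroup (genLE S ℳ d ⧸ (genLE S ℳ (d - 1)).submoduleOf (genLE S ℳ d)))

instance (ℳ : ℤ → AddSubgroup M) (d : ℤ) : Module S (Piece S ℳ d) :=
  inferInstanceAs
    (Module S (genLE S ℳ d ⧸ (genLE S ℳ (d - 1)).submoduleOf (genLE S ℳ d)))

/-- The associated graded module `gr(M) = ⨁_d M_⟨≤d⟩ / M_⟨≤d-1⟩`. Up to re-indexing the bigraded
pieces this is the associated graded module of the `𝔪`-adic filtration, because `𝔪 ^ i M` and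
`M_⟨≤j-i⟩` have the same degree `j` part, see `mem_maxIdeal_pow_smul_iff`. -/
abbrev Gr (S : Type v) [CommRing S] {M : Type w} [AddCommGroup M] [Module S M]
    (ℳ : ℤ → AddSubgroup M) : Type w :=
  ⨁ d : ℤ, Piece S ℳ d

/-- The map on subquotients induced by a linear map sending `M_⟨≤D⟩` into `N_⟨≤D+c⟩` for all `D`,
where `d' = d + c`. -/
def pieceMap {N : Type*} [AddCommGroup N] [Module S N] (ℳ : ℤ → AddSubgroup M)
    (𝒩 : ℤ → AddSubgroup N) (f : M →ₗ[S] N) (c : ℤ)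
    (hf : ∀ D, ∀ x ∈ genLE S ℳ D, f x ∈ genLE S 𝒩 (D + c)) (d d' : ℤ) (hd : d' = d + c) :
    Piece S ℳ d →ₗ[S] Piece S 𝒩 d' :=
  Submodule.mapQ _ _ (f.restrict (p := genLE S ℳ d) (q := genLE S 𝒩 d')
      (fun x hx => hd ▸ hf d x hx))
    (fun x hx => by
      have h := hf (d - 1) x hx
      have e : d - 1 + c = d' - 1 := by omega
      rw [e] at h
      exact h)

end Filtration

section Comparison

variable {k : Type u} [Field k] {S : Type v} [CommRing S] [Algebra k S]
  {𝒜 : ℕ → Submodule k S} [GradedAlgebra 𝒜]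

theorem component_mem_maxIdeal_pow (hS : IsStandardGraded 𝒜) (s : S) (a : ℕ) :
    (DirectSum.decompose 𝒜 s a : S) ∈ maxIdeal 𝒜 ^ a := by
  classical
  have hs : s ∈ Algebra.adjoin k (𝒜 1 : Set S) := by rw [hS.adjoin_degree_one]; trivial
  induction hs using Algebra.adjoin_induction generalizing a with
  | mem s hs =>
    by_cases h : a = 1
    · subst h
      rw [pow_one]
      refine (HomogeneousIdeal.mem_irrelevant_iff 𝒜 _).2 ?_
      rw [GradedRing.proj_apply, DirectSum.decompose_of_mem_same 𝒜 hs]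
      exact DirectSum.decompose_of_mem_ne 𝒜 hs one_ne_zero
    · rw [DirectSum.decompose_of_mem_ne 𝒜 hs (Ne.symm h)]
      exact Submodule.zero_mem _
  | algebraMap c =>
    by_cases h : a = 0
    · subst h; simp
    · rw [DirectSum.decompose_of_mem_ne 𝒜 (SetLike.algebraMap_mem_graded 𝒜 c) (Ne.symm h)]
      exact Submodule.zero_mem _
  | add s t _ _ hs ht =>
    rw [DirectSum.decompose_add, DirectSum.add_apply]
    exact Submodule.add_mem _ (hs a) (ht a)
  | mul s t _ _ hs ht =>
    rw [DirectSum.decompose_mul, DirectSum.coe_mul_apply]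
    refine Submodule.sum_mem _ fun p hp => ?_
    rw [← (Finset.mem_filter.1 hp).2, pow_add]
    exact Ideal.mul_mem_mul (hs _) (ht _)

theorem component_eq_zero_of_mem_maxIdeal_pow (i : ℕ) (s : S) (hs : s ∈ maxIdeal 𝒜 ^ i) (a : ℕ)
    (ha : a < i) : (DirectSum.decompose 𝒜 s a : S) = 0 := by
  classical
  induction i generalizing s a with
  | zero => omega
  | succ i ih =>
    rw [pow_succ] at hs
    induction hs using Submodule.mul_induction_on' with
    | mem_mul_mem s hs t ht =>
      rw [DirectSum.decompose_mul, DirectSum.coe_mul_apply]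
      refine Finset.sum_eq_zero fun p hp => ?_
      have hp := (Finset.mem_filter.1 hp).2
      by_cases h : p.2 = 0
      · have h2 := (HomogeneousIdeal.mem_irrelevant_iff 𝒜 _).1 ht
        rw [GradedRing.proj_apply] at h2
        rw [h, h2, mul_zero]
      · rw [ih s hs p.1 (by omega), zero_mul]
    | add s _ t _ hs ht => simp [DirectSum.decompose_add, hs, ht]

variable {M : Type w} [AddCommGroup M] [Module S M] {ℳ : ℤ → AddSubgroup M}

/-- In degree `j` the submodules `𝔪 ^ i M` and `M_⟨≤j-i⟩` agree. -/
theorem mem_maxIdeal_pow_smul_iff (hS : IsStandardGraded 𝒜) (hM : IsGradedModule 𝒜 ℳ) {j : ℤ}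
    {x : M} (hx : x ∈ ℳ j) (i : ℕ) :
    x ∈ maxIdeal 𝒜 ^ i • (⊤ : Submodule S M) ↔ x ∈ genLE S ℳ (j - i) := by
  classical
  let _ := hM.isInternal.chooseDecomposition
  constructor
  · intro h
    suffices ∀ c : ℤ, (DirectSum.decompose ℳ x c : M) ∈ genLE S ℳ (c - i) by
      simpa [DirectSum.decompose_of_mem_same ℳ hx] using this j
    clear hx
    induction h using Submodule.smul_induction_on' with
    | smul s hs y _ =>
      intro c
      rw [← DirectSum.sum_support_decompose 𝒜 s, Finset.sum_smul, DirectSum.decompose_sum,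
        DirectSum.sum_apply, AddSubgroup.val_finsetSum]
      refine Submodule.sum_mem _ fun a _ => ?_
      rw [← DirectSum.sum_support_decompose ℳ y, Finset.smul_sum, DirectSum.decompose_sum,
        DirectSum.sum_apply, AddSubgroup.val_finsetSum]
      refine Submodule.sum_mem _ fun b _ => ?_
      have hmem := hM.smul_mem a b _ _ (DirectSum.decompose 𝒜 s a).2 (DirectSum.decompose ℳ y b).2
      by_cases hc : (a : ℤ) + b = c
      · subst hc
        rw [DirectSum.decompose_of_mem_same ℳ hmem]
        by_cases ha : a < i
        · rw [component_eq_zero_of_mem_maxIdeal_pow i s hs a ha, zero_smul]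
          exact Submodule.zero_mem _
        · exact Submodule.smul_mem _ _
            (Submodule.subset_span ⟨b, by omega, (DirectSum.decompose ℳ y b).2⟩)
      · rw [DirectSum.decompose_of_mem_ne ℳ hmem hc]
        exact Submodule.zero_mem _
    | add y _ z _ hy hz =>
      intro c
      rw [DirectSum.decompose_add, DirectSum.add_apply]
      exact Submodule.add_mem _ (hy c) (hz c)
  · intro h
    suffices ∀ c : ℤ, (DirectSum.decompose ℳ x c : M) ∈
        maxIdeal 𝒜 ^ (c - (j - i)).toNat • (⊤ : Submodule S M) by
      simpa [DirectSum.decompose_of_mem_same ℳ hx] using this j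
    clear hx
    induction h using Submodule.closure_induction with
    | zero => intro c; simp
    | add y z _ _ hy hz =>
      intro c
      rw [DirectSum.decompose_add, DirectSum.add_apply]
      exact Submodule.add_mem _ (hy c) (hz c)
    | smul_mem s z hz =>
      obtain ⟨e, he, hz⟩ := hz
      intro c
      rw [← DirectSum.sum_support_decompose 𝒜 s, Finset.sum_smul, DirectSum.decompose_sum,
        DirectSum.sum_apply, AddSubgroup.val_finsetSum]
      refine Submodule.sum_mem _ fun a _ => ?_
      have hmem := hM.smul_mem a e _ _ (DirectSum.decompose 𝒜 s a).2 hz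
      by_cases hc : (a : ℤ) + e = c
      · subst hc
        rw [DirectSum.decompose_of_mem_same ℳ hmem]
        exact Submodule.smul_mem_smul (Ideal.pow_le_pow_right (by omega)
          (component_mem_maxIdeal_pow hS s a)) trivial
      · rw [DirectSum.decompose_of_mem_ne ℳ hmem hc]
        exact Submodule.zero_mem _

end Comparison

section Resolution

variable {k : Type u} [Field k] {S : Type v} [CommRing S] [Algebra k S]

/-- A minimal graded free resolution `⋯ → F₂ → F₁ → F₀ → M → 0` of a graded `S`-module `M`, with
`F_n = ⨁ₗ S(-deg n l)` of finite rank. The maps are homogeneous of degree zero, and minimality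
says that `∂(F_{n+1}) ⊆ 𝔪 F_n`. -/
structure MinFreeRes (𝒜 : ℕ → Submodule k S) [GradedAlgebra 𝒜] {M : Type w} [AddCommGroup M]
    [Module S M] (ℳ : ℤ → AddSubgroup M) where
  rank : ℕ → ℕ
  deg : ∀ n, Fin (rank n) → ℤ
  d : ∀ n, (Fin (rank (n + 1)) → S) →ₗ[S] (Fin (rank n) → S)
  ε : (Fin (rank 0) → S) →ₗ[S] M
  d_homogeneous : ∀ n l, d n (Pi.single l 1) ∈ freeGrading 𝒜 (deg n) (deg (n + 1) l)
  ε_homogeneous : ∀ l, ε (Pi.single l 1) ∈ ℳ (deg 0 l)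
  minimal : ∀ n x l, d n x l ∈ maxIdeal 𝒜
  exact_succ : ∀ n, Function.Exact (d (n + 1)) (d n)
  exact_zero : Function.Exact (d 0) ε
  surjective : Function.Surjective ε

/-- `M` has a linear resolution: for some `d`, each `F_i` is generated in degree `i + d`. -/
def HasLinearResolution (𝒜 : ℕ → Submodule k S) [GradedAlgebra 𝒜] {M : Type w} [AddCommGroup M]
    [Module S M] (ℳ : ℤ → AddSubgroup M) : Prop :=
  ∃ (d : ℤ) (F : MinFreeRes 𝒜 ℳ), ∀ i l, F.deg i l = (i : ℤ) + d

/-- Condition `N_{d,p}`: `M` is generated in degree `d`, and in its minimal graded free resolution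
`F_i` is generated in degree `i + d` for `i < p`. -/
def SatisfiesN (𝒜 : ℕ → Submodule k S) [GradedAlgebra 𝒜] {M : Type w} [AddCommGroup M]
    [Module S M] (ℳ : ℤ → AddSubgroup M) (d : ℤ) (p : ℕ) : Prop :=
  genAt S ℳ d = ⊤ ∧ ∃ F : MinFreeRes 𝒜 ℳ, ∀ i < p, ∀ l, F.deg i l = (i : ℤ) + d

/-- `M` is componentwise linear in the first `p` steps: `M_⟨d⟩` satisfies `N_{d,p}` for all `d`. -/
def IsComponentwiseLinearUpTo (𝒜 : ℕ → Submodule k S) [GradedAlgebra 𝒜] {M : Type w}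
    [AddCommGroup M] [Module S M] (ℳ : ℤ → AddSubgroup M) (p : ℕ) : Prop :=
  ∀ d : ℤ, SatisfiesN 𝒜 (subGrading ℳ (genAt S ℳ d)) d p

/-- `S` is a Koszul algebra: the residue field `k = S/𝔪` has a linear resolution over `S`. -/
def IsKoszul (𝒜 : ℕ → Submodule k S) [GradedAlgebra 𝒜] : Prop :=
  HasLinearResolution 𝒜 (residueGrading 𝒜)

variable {𝒜 : ℕ → Submodule k S} [GradedAlgebra 𝒜]

theorem single_mem_freeGrading {b : ℕ} (a : Fin b → ℤ) (l : Fin b) :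
    (Pi.single l 1 : Fin b → S) ∈ freeGrading 𝒜 a (a l) := by
  intro l'
  by_cases h : l' = l
  · subst h
    simpa [intDegree] using SetLike.GradedOne.one_mem (A := 𝒜)
  · simp [h]

theorem mem_genLE_freeGrading {b : ℕ} (a : Fin b → ℤ) (D : ℤ) (x : Fin b → S) :
    x ∈ genLE S (freeGrading 𝒜 a) D ↔ ∀ l, D < a l → x l = 0 := by
  constructor
  · intro hx
    induction hx using Submodule.span_induction with
    | mem x hx =>
      obtain ⟨e, he, hx⟩ := hx
      intro l hl
      have := hx l
      rw [intDegree, if_neg (by omega)] at this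
      simpa using this
    | zero => simp
    | add x y _ _ hx hy => intro l hl; simp [hx l hl, hy l hl]
    | smul s x _ hx => intro l hl; simp [hx l hl]
  · intro hx
    rw [pi_eq_sum_univ' x]
    refine Submodule.sum_mem _ fun l _ => ?_
    by_cases h : D < a l
    · simp [hx l h]
    · refine Submodule.smul_mem _ _ (Submodule.subset_span ⟨a l, by omega, ?_⟩)
      convert single_mem_freeGrading (𝒜 := 𝒜) a l using 1

namespace MinFreeRes

variable {M : Type w} [AddCommGroup M] [Module S M] {ℳ : ℤ → AddSubgroup M}

/-- The grading of `F_n`. -/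
def grading (F : MinFreeRes 𝒜 ℳ) (n : ℕ) : ℤ → AddSubgroup (Fin (F.rank n) → S) :=
  freeGrading 𝒜 (F.deg n)

/-- By minimality `∂` sends `(F_{n+1})_⟨≤D⟩` into `(F_n)_⟨≤D-1⟩`. -/
theorem d_mem_genLE (F : MinFreeRes 𝒜 ℳ) (n : ℕ) (D : ℤ) (x : Fin (F.rank (n + 1)) → S)
    (hx : x ∈ genLE S (F.grading (n + 1)) D) : F.d n x ∈ genLE S (F.grading n) (D + -1) := by
  rw [grading, mem_genLE_freeGrading] at hx ⊢
  intro l' hl'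
  rw [LinearMap.pi_apply_eq_sum_univ (F.d n) x, Finset.sum_apply]
  refine Finset.sum_eq_zero fun l _ => ?_
  by_cases h : D < F.deg (n + 1) l
  · simp [hx l h]
  · have key : F.d n (Pi.single l 1) l' = 0 := by
      have h1 := F.d_homogeneous n l l'
      have h2 := F.minimal n (Pi.single l 1) l'
      rw [intDegree] at h1
      split_ifs at h1 with hs
      · have h0 : (F.deg (n + 1) l - F.deg n l').toNat = 0 := by omega
        rw [h0] at h1
        have h3 := (HomogeneousIdeal.mem_irrelevant_iff 𝒜 _).1 h2
        rw [GradedRing.proj_apply, DirectSum.decompose_of_mem_same 𝒜 h1] at h3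
        exact h3
      · simpa using h1
    have e : (fun j => if l = j then (1 : S) else 0) = Pi.single l 1 := by
      ext j
      simp [Pi.single_apply, eq_comm]
    simp [e, key]

theorem ε_mem_genLE (F : MinFreeRes 𝒜 ℳ) (D : ℤ) (x : Fin (F.rank 0) → S)
    (hx : x ∈ genLE S (F.grading 0) D) : F.ε x ∈ genLE S ℳ (D + 0) := by
  rw [grading, mem_genLE_freeGrading] at hx
  rw [LinearMap.pi_apply_eq_sum_univ F.ε x]
  refine Submodule.sum_mem _ fun l _ => ?_
  by_cases h : D < F.deg 0 l
  · simp [hx l h]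
  · refine Submodule.smul_mem _ _ (Submodule.subset_span ⟨F.deg 0 l, by omega, ?_⟩)
    convert F.ε_homogeneous l using 2
    ext j
    simp [Pi.single_apply, eq_comm]

/-- The term in homological degree `n` of the `d`-linear strand `F_⟨d⟩ = F_⟨≤d⟩ / F_⟨≤d-1⟩`,
where `(F_⟨≤d⟩)_n = (F_n)_⟨≤d+n⟩`. -/
abbrev Strand (F : MinFreeRes 𝒜 ℳ) (d : ℤ) (n : ℕ) : Type v :=
  Piece S (F.grading n) (d + n)

/-- The differential of the `d`-linear strand, induced by that of `F`. -/
def strandD (F : MinFreeRes 𝒜 ℳ) (d : ℤ) (n : ℕ) : F.Strand d (n + 1) →ₗ[S] F.Strand d n :=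
  pieceMap (F.grading (n + 1)) (F.grading n) (F.d n) (-1) (F.d_mem_genLE n) _ _
    (by push_cast; ring)

/-- The augmentation `F_⟨d⟩ → M_⟨≤d⟩ / M_⟨≤d-1⟩`, induced by `F₀ → M`. -/
def strandAug (F : MinFreeRes 𝒜 ℳ) (d : ℤ) : F.Strand d 0 →ₗ[S] Piece S ℳ d :=
  pieceMap (F.grading 0) ℳ F.ε 0 F.ε_mem_genLE _ _ (by simp)

/-- The linear part `lin(F) = ⨁_d F_⟨d⟩`, in homological degree `n`. -/
abbrev Lin (F : MinFreeRes 𝒜 ℳ) (n : ℕ) : Type v :=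
  ⨁ d : ℤ, F.Strand d n

/-- The differential `lin(F)_{n+1} → lin(F)_n`. -/
def linD (F : MinFreeRes 𝒜 ℳ) (n : ℕ) : F.Lin (n + 1) →ₗ[S] F.Lin n :=
  DirectSum.lmap fun d => F.strandD d n

/-- The augmentation `lin(F)_0 → gr(M)`. -/
def linAug (F : MinFreeRes 𝒜 ℳ) : F.Lin 0 →ₗ[S] Gr S ℳ :=
  DirectSum.lmap fun d => F.strandAug d

theorem strandD_comp (F : MinFreeRes 𝒜 ℳ) (d : ℤ) (n : ℕ) :
    F.strandD d n ∘ₗ F.strandD d (n + 1) = 0 := by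
  refine Submodule.linearMap_qext _ (LinearMap.ext fun x => ?_)
  have h : F.d n (F.d (n + 1) x.1) = 0 := (F.exact_succ n).apply_apply_eq_zero x.1
  refine (Submodule.Quotient.mk_eq_zero _).2 ?_
  change F.d n (F.d (n + 1) x.1) ∈ genLE S (F.grading n) (d + n - 1)
  rw [h]
  exact Submodule.zero_mem _

theorem strandAug_comp (F : MinFreeRes 𝒜 ℳ) (d : ℤ) :
    F.strandAug d ∘ₗ F.strandD d 0 = 0 := by
  refine Submodule.linearMap_qext _ (LinearMap.ext fun x => ?_)
  have h : F.ε (F.d 0 x.1) = 0 := F.exact_zero.apply_apply_eq_zero x.1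
  refine (Submodule.Quotient.mk_eq_zero _).2 ?_
  change F.ε (F.d 0 x.1) ∈ genLE S ℳ (d - 1)
  rw [h]
  exact Submodule.zero_mem _

theorem linD_comp (F : MinFreeRes 𝒜 ℳ) (n : ℕ) : F.linD n ∘ₗ F.linD (n + 1) = 0 := by
  refine DirectSum.linearMap_ext S fun d => LinearMap.ext fun x => ?_
  have h : F.strandD d n (F.strandD d (n + 1) x) = 0 :=
    LinearMap.congr_fun (F.strandD_comp d n) x
  simp [linD, DirectSum.lmap_lof, h]

theorem linAug_comp (F : MinFreeRes 𝒜 ℳ) : F.linAug ∘ₗ F.linD 0 = 0 := by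
  refine DirectSum.linearMap_ext S fun d => LinearMap.ext fun x => ?_
  have h : F.strandAug d (F.strandD d 0 x) = 0 :=
    LinearMap.congr_fun (F.strandAug_comp d) x
  simp [linAug, linD, DirectSum.lmap_lof, h]

/-- The differential of `lin(F)` leaving homological degree `n`, which is zero for `n = 0`. -/
def linFrom (F : MinFreeRes 𝒜 ℳ) : ∀ n, F.Lin n →ₗ[S] F.Lin (n - 1)
  | 0 => 0
  | n + 1 => F.linD n

/-- The homology `H_n(lin(F))`, cycles modulo boundaries. -/
abbrev LinHomology (F : MinFreeRes 𝒜 ℳ) (n : ℕ) : Type v :=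
  LinearMap.ker (F.linFrom n) ⧸ (LinearMap.range (F.linD n)).submoduleOf (LinearMap.ker (F.linFrom n))

/-- The natural map `H_0(lin(F)) → gr(M)`. -/
def linHomologyZeroToGr (F : MinFreeRes 𝒜 ℳ) : F.LinHomology 0 →ₗ[S] Gr S ℳ :=
  Submodule.liftQ _ (F.linAug ∘ₗ (LinearMap.ker (F.linFrom 0)).subtype) (by
    intro x hx
    obtain ⟨y, hy⟩ := hx
    have h : F.linAug (F.linD 0 y) = 0 := LinearMap.congr_fun F.linAug_comp y
    rw [hy] at h
    exact h)

end MinFreeRes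

end Resolution

end GradedLin

end

/-! Both sides are translated into vanishing of `Tor` with the residue field. Koszulness supplies a
resolution `K` of `k` whose differentials are matrices of linear forms. Hence the component of
`Tor_i(P, k)` in internal degree `i + e` is computed by vectors over `P` with entries of degree `e`,
modulo boundaries of vectors with entries of degree `e - 1`, up to the common shift of `K`. Call `P`
linear up to step `r` above `D` if this vanishes for `0 < i ≤ r` and `e > D`.

The engine is dimension shifting, `torLinear_map_succ_iff`. Let `C = F_⟨≤D⟩` be a truncated free
module and `Z` the kernel of a map `f` on `C`. Since `C` has no `Tor` above `D`, linearity of `f(C)`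
amounts to linearity of `Z` above `D + 1` together with vanishing of `Tor_0(Z)` there. The latter
says that `Z` is generated in degrees at most `D + 1`, that is, that the next truncated term of the
resolution maps onto `Z`. Iterating, `torLinear_genLE_iff` shows that `M_⟨≤d⟩` is linear up to step
`r` exactly when `F_⟨≤d⟩ → M_⟨≤d⟩` is exact in homological degrees below `r`.

On the side of `lin(F)`, the strands are the successive quotients of the filtration of `F` by the
truncations `F_⟨≤d⟩`, which vanish in each homological degree for `d` small. Exactness of all
strands below `r` is therefore equivalent to exactness of all truncations below `r`
(`linHomology_iff_truncExact`).

On the side of componentwise linearity, `M_⟨d⟩` and `M_⟨≤d⟩` agree in degrees at least `d`, so the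
same `Tor` groups occur (`torVanishes_subGrading_iff`). For a module generated in degree `d`,
linearity of a minimal resolution `G` is exactness of its own truncation `G_⟨≤d⟩`
(`deg_eq_iff_truncExact`), so `torLinear_genLE_iff`, now applied to `G`, turns it into `Tor`. Thus
`F` and `G` are never compared directly. -/

noncomputable section

namespace GradedLin

universe u v w

set_option linter.unusedSectionVars false

/-! ### Homogeneous components in integer degrees -/

section Projections

variable {k : Type u} [Field k] {S : Type v} [CommRing S] [Algebra k S]

/-- The projection of `S` to its part of integer degree `z`. -/
def intComp (𝒜 : ℕ → Submodule k S) [GradedAlgebra 𝒜] (z : ℤ) : S →+ S :=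
  if 0 ≤ z then GradedRing.proj 𝒜 z.toNat else 0

variable {𝒜 : ℕ → Submodule k S} [GradedAlgebra 𝒜]

theorem mem_intDegree_natCast {i : ℕ} {s : S} : s ∈ intDegree 𝒜 i ↔ s ∈ 𝒜 i := by
  simp [intDegree]

theorem intComp_mem (z : ℤ) (s : S) : intComp 𝒜 z s ∈ intDegree 𝒜 z := by
  unfold intComp intDegree
  split_ifs
  · exact (DirectSum.decompose 𝒜 s z.toNat).2
  · simp

theorem intComp_of_mem {i : ℕ} {s : S} (hs : s ∈ 𝒜 i) (z : ℤ) :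
    intComp 𝒜 z s = if (i : ℤ) = z then s else 0 := by
  unfold intComp
  by_cases hz : 0 ≤ z
  · rw [if_pos hz, GradedRing.proj_apply]
    by_cases h : (i : ℤ) = z
    · have : z.toNat = i := by omega
      rw [if_pos h, this, DirectSum.decompose_of_mem_same 𝒜 hs]
    · rw [if_neg h, DirectSum.decompose_of_mem_ne 𝒜 hs (by omega)]
  · rw [if_neg hz, if_neg (by omega)]
    rfl

theorem intComp_of_mem_intDegree {z z' : ℤ} {s : S} (hs : s ∈ intDegree 𝒜 z) :
    intComp 𝒜 z' s = if z = z' then s else 0 := by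
  by_cases hz : 0 ≤ z
  · rw [← Int.toNat_of_nonneg hz, mem_intDegree_natCast] at hs
    rw [intComp_of_mem hs, Int.toNat_of_nonneg hz]
  · rw [intDegree, if_neg hz, Submodule.mem_bot] at hs
    simp [hs]

theorem intComp_zero_eq_zero_iff {s : S} : intComp 𝒜 0 s = 0 ↔ s ∈ maxIdeal 𝒜 :=
  (HomogeneousIdeal.mem_irrelevant_iff 𝒜 s).symm

theorem one_notMem_maxIdeal (hS : IsStandardGraded 𝒜) : (1 : S) ∉ maxIdeal 𝒜 := by
  rw [← intComp_zero_eq_zero_iff,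
    intComp_of_mem (i := 0) (SetLike.GradedOne.one_mem (A := 𝒜))]
  have := hS.nontrivial
  simp

theorem mem_maxIdeal_of_mem_one {s : S} (hs : s ∈ 𝒜 1) : s ∈ maxIdeal 𝒜 := by
  rw [← intComp_zero_eq_zero_iff, intComp_of_mem hs]
  simp

variable {M : Type w} [AddCommGroup M] [Module S M] {ℳ : ℤ → AddSubgroup M}

/-- The projection of a graded module to its part of degree `e`. -/
def IsGradedModule.proj (hM : IsGradedModule 𝒜 ℳ) (e : ℤ) : M →+ M :=
  let _ := hM.isInternal.chooseDecomposition
  (ℳ e).subtype.comp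
    ((DFinsupp.evalAddMonoidHom e).comp (DirectSum.decomposeAddEquiv ℳ).toAddMonoidHom)

namespace IsGradedModule

theorem proj_mem (hM : IsGradedModule 𝒜 ℳ) (e : ℤ) (x : M) : hM.proj e x ∈ ℳ e :=
  SetLike.coe_mem _

theorem proj_of_mem (hM : IsGradedModule 𝒜 ℳ) {e : ℤ} {x : M} (hx : x ∈ ℳ e) (e' : ℤ) :
    hM.proj e' x = if e = e' then x else 0 := by
  let _ := hM.isInternal.chooseDecomposition
  change (DirectSum.decompose ℳ x e' : M) = _
  split_ifs with h
  · subst h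
    exact DirectSum.decompose_of_mem_same ℳ hx
  · exact DirectSum.decompose_of_mem_ne ℳ hx h

theorem proj_self (hM : IsGradedModule 𝒜 ℳ) {e : ℤ} {x : M} (hx : x ∈ ℳ e) :
    hM.proj e x = x := by
  rw [hM.proj_of_mem hx, if_pos rfl]

theorem exists_sum_proj (hM : IsGradedModule 𝒜 ℳ) (x : M) :
    ∃ s : Finset ℤ, x = ∑ e ∈ s, hM.proj e x := by
  classical
  let _ := hM.isInternal.chooseDecomposition
  exact ⟨_, (DirectSum.sum_support_decompose ℳ x).symm⟩

theorem induction_on (hM : IsGradedModule 𝒜 ℳ) {p : M → Prop} (x : M) (h0 : p 0)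
    (hadd : ∀ x y, p x → p y → p (x + y)) (hom : ∀ e, ∀ x ∈ ℳ e, p x) : p x := by
  obtain ⟨s, hs⟩ := hM.exists_sum_proj x
  rw [hs]
  exact Finset.sum_induction _ p hadd h0 fun e _ => hom e _ (hM.proj_mem e x)

theorem smul_mem' (hM : IsGradedModule 𝒜 ℳ) {z e e' : ℤ} {s : S} {x : M}
    (hs : s ∈ intDegree 𝒜 z) (hx : x ∈ ℳ e) (h : e' = z + e) : s • x ∈ ℳ e' := by
  subst h
  by_cases hz : 0 ≤ z
  · rw [← Int.toNat_of_nonneg hz, mem_intDegree_natCast] at hs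
    have := hM.smul_mem _ _ _ _ hs hx
    rwa [Int.toNat_of_nonneg hz] at this
  · rw [intDegree, if_neg hz, Submodule.mem_bot] at hs
    simp [hs]

/-- This lets span inductions run on projections of arbitrary elements, since homogeneity itself
does not survive the induction. -/
theorem proj_smul_of_mem (hM : IsGradedModule 𝒜 ℳ) {j : ℤ} {x : M} (hx : x ∈ ℳ j) (s : S)
    (e : ℤ) : hM.proj e (s • x) = intComp 𝒜 (e - j) s • x := by
  induction s using DirectSum.Decomposition.inductionOn 𝒜 with
  | zero => simp
  | @homogeneous i m =>
    rw [hM.proj_of_mem (hM.smul_mem i j m x m.2 hx), intComp_of_mem m.2]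
    by_cases h : (i : ℤ) + j = e
    · rw [if_pos h, if_pos (by omega)]
    · rw [if_neg h, if_neg (by omega), zero_smul]
  | add s t hs ht => rw [add_smul, map_add, hs, ht, map_add, add_smul]

/-- The maps `p e` read off the components of a sum, so the sum map is injective. -/
theorem isInternal_of_proj {p : ℤ → M →+ M} (hp : ∀ e e', ∀ x ∈ ℳ e, p e' x = if e = e' then x else 0)
    (hsum : ∀ x, x ∈ ⨆ e, ℳ e) : DirectSum.IsInternal ℳ := by
  classical
  constructor
  · rw [← AddMonoidHom.coe_coe, injective_iff_map_eq_zero]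
    intro x hx
    ext e
    have key : ∀ y : ⨁ e, ℳ e, p e (DirectSum.coeAddMonoidHom ℳ y) = y e := by
      intro y
      induction y using DirectSum.induction_on with
      | zero => simp
      | of i z =>
        rw [DirectSum.coeAddMonoidHom_of, hp i e z z.2]
        split_ifs with h
        · subst h; simp
        · rw [DirectSum.of_eq_of_ne _ _ _ (Ne.symm h)]; rfl
      | add y z hy hz => simp [hy, hz]
    rw [← key x]
    simpa using congrArg (p e) hx
  · intro x
    induction hsum x using AddSubgroup.iSup_induction' with
    | hp e x hx => exact ⟨DirectSum.of (fun e => ℳ e) e ⟨x, hx⟩, by simp⟩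
    | h1 => exact ⟨0, by simp⟩
    | hadd x y _ _ hx hy =>
      obtain ⟨a, ha⟩ := hx
      obtain ⟨b, hb⟩ := hy
      exact ⟨a + b, by rw [map_add, ha, hb]⟩

end IsGradedModule

end Projections

/-! ### Graded free modules, graded submodules and homogeneous maps -/

section GradedModules

variable {k : Type u} [Field k] {S : Type v} [CommRing S] [Algebra k S]
  {𝒜 : ℕ → Submodule k S} [GradedAlgebra 𝒜]

/-- The projection of the graded free module to its part of degree `e`. -/
def freeProj (𝒜 : ℕ → Submodule k S) [GradedAlgebra 𝒜] {b : ℕ} (a : Fin b → ℤ) (e : ℤ) :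
    (Fin b → S) →+ (Fin b → S) where
  toFun x l := intComp 𝒜 (e - a l) (x l)
  map_zero' := by ext; simp
  map_add' x y := by ext; simp

@[simp]
theorem freeProj_apply {b : ℕ} (a : Fin b → ℤ) (e : ℤ) (x : Fin b → S) (l : Fin b) :
    freeProj 𝒜 a e x l = intComp 𝒜 (e - a l) (x l) := rfl

theorem freeProj_mem {b : ℕ} (a : Fin b → ℤ) (e : ℤ) (x : Fin b → S) :
    freeProj 𝒜 a e x ∈ freeGrading 𝒜 a e :=
  fun l => intComp_mem _ (x l)

theorem single_mem_freeGrading_of_mem {b : ℕ} (a : Fin b → ℤ) (l : Fin b) {i : ℕ} {s : S}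
    (hs : s ∈ 𝒜 i) : (Pi.single l s : Fin b → S) ∈ freeGrading 𝒜 a (i + a l) := by
  intro l'
  by_cases h : l' = l
  · subst h
    simpa [mem_intDegree_natCast] using hs
  · simp [h]

theorem isGradedModule_freeGrading {b : ℕ} (a : Fin b → ℤ) :
    IsGradedModule 𝒜 (freeGrading 𝒜 a) where
  isInternal := by
    refine IsGradedModule.isInternal_of_proj (p := freeProj 𝒜 a) ?_ ?_
    · intro e e' x hx
      ext l
      rw [freeProj_apply, intComp_of_mem_intDegree (hx l)]
      by_cases h : e = e'
      · simp [h]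
      · rw [if_neg (by omega), if_neg h]; rfl
    · intro x
      rw [← Finset.univ_sum_single x]
      refine AddSubgroup.sum_mem _ fun l _ => ?_
      generalize x l = s
      induction s using DirectSum.Decomposition.inductionOn 𝒜 with
      | zero => simp
      | homogeneous m =>
        exact (le_iSup (freeGrading 𝒜 a) _) (single_mem_freeGrading_of_mem a l m.2)
      | add s t hs ht => rw [Pi.single_add]; exact AddSubgroup.add_mem _ hs ht
  smul_mem i j s x hs hx l := by
    have h := hx l
    rw [Pi.smul_apply, smul_eq_mul]
    unfold intDegree at h ⊢
    split_ifs at h with h0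
    · rw [if_pos (by omega)]
      have e : ((i : ℤ) + j - a l).toNat = i + (j - a l).toNat := by omega
      rw [e]
      exact SetLike.GradedMul.mul_mem hs h
    · rw [Submodule.mem_bot] at h
      rw [h, mul_zero]
      exact Submodule.zero_mem _

variable {M : Type w} [AddCommGroup M] [Module S M] {ℳ : ℤ → AddSubgroup M}

theorem isGradedModule_subGrading (hM : IsGradedModule 𝒜 ℳ) {N : Submodule S M}
    (hN : ∀ x ∈ N, ∀ e, hM.proj e x ∈ N) : IsGradedModule 𝒜 (subGrading ℳ N) where
  isInternal := by
    let p : ℤ → N →+ N := fun e =>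
      ((hM.proj e).comp N.subtype.toAddMonoidHom).codRestrict N fun x => hN x x.2 e
    have hp : ∀ e x, ((p e x : N) : M) = hM.proj e x := fun _ _ => rfl
    refine IsGradedModule.isInternal_of_proj (p := p) ?_ ?_
    · intro e e' x hx
      apply Subtype.ext
      have hx : (x : M) ∈ ℳ e := hx
      rw [hp, hM.proj_of_mem hx]
      split_ifs <;> rfl
    · intro x
      obtain ⟨s, hs⟩ := hM.exists_sum_proj (x : M)
      have : x = ∑ e ∈ s, p e x := by
        apply Subtype.ext
        rw [AddSubmonoidClass.coe_finsetSum]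
        exact hs
      rw [this]
      refine AddSubgroup.sum_mem _ fun e _ => (le_iSup (subGrading ℳ N) e) ?_
      exact hM.proj_mem e x
  smul_mem i j s x hs hx := hM.smul_mem i j s x hs hx

theorem proj_mem_genLE (hM : IsGradedModule 𝒜 ℳ) {D : ℤ} {x : M} (hx : x ∈ genLE S ℳ D) (e : ℤ) :
    hM.proj e x ∈ genLE S ℳ D := by
  induction hx using Submodule.closure_induction with
  | zero => simp
  | add x y _ _ hx hy => rw [map_add]; exact Submodule.add_mem _ hx hy
  | smul_mem s x hx =>
    obtain ⟨e', he', hx⟩ := hx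
    rw [hM.proj_smul_of_mem hx]
    exact Submodule.smul_mem _ _ (Submodule.subset_span ⟨e', he', hx⟩)

theorem proj_mem_genAt (hM : IsGradedModule 𝒜 ℳ) {d : ℤ} {x : M} (hx : x ∈ genAt S ℳ d) (e : ℤ) :
    hM.proj e x ∈ genAt S ℳ d := by
  induction hx using Submodule.closure_induction with
  | zero => simp
  | add x y _ _ hx hy => rw [map_add]; exact Submodule.add_mem _ hx hy
  | smul_mem s x hx =>
    rw [hM.proj_smul_of_mem hx]
    exact Submodule.smul_mem _ _ (Submodule.subset_span hx)

theorem mem_genLE_of_mem {D e : ℤ} {x : M} (h : e ≤ D) (hx : x ∈ ℳ e) : x ∈ genLE S ℳ D :=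
  Submodule.subset_span ⟨e, h, hx⟩

theorem genLE_mono {D D' : ℤ} (h : D ≤ D') : genLE S ℳ D ≤ genLE S ℳ D' :=
  Submodule.span_mono fun _ ⟨e, he, hx⟩ => ⟨e, he.trans h, hx⟩

theorem apply_eq_sum_single {b : ℕ} (f : (Fin b → S) →ₗ[S] M) (v : Fin b → S) :
    f v = ∑ l, v l • f (Pi.single l 1) := by
  conv_lhs => rw [← Finset.univ_sum_single v]
  rw [map_sum]
  refine Finset.sum_congr rfl fun l _ => ?_
  rw [← map_smul, ← Pi.single_smul, smul_eq_mul, mul_one]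

/-- A homogeneous map from a graded free module commutes with the projections. -/
theorem map_freeProj (hM : IsGradedModule 𝒜 ℳ) {b : ℕ} {a : Fin b → ℤ} (f : (Fin b → S) →ₗ[S] M)
    (hf : ∀ l, f (Pi.single l 1) ∈ ℳ (a l)) (e : ℤ) (u : Fin b → S) :
    f (freeProj 𝒜 a e u) = hM.proj e (f u) := by
  rw [apply_eq_sum_single f, apply_eq_sum_single f u, map_sum]
  exact Finset.sum_congr rfl fun l _ => (hM.proj_smul_of_mem (hf l) _ _).symm

theorem proj_freeGrading {b : ℕ} (a : Fin b → ℤ) (e : ℤ) (x : Fin b → S) :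
    (isGradedModule_freeGrading (𝒜 := 𝒜) a).proj e x = freeProj 𝒜 a e x :=
  (map_freeProj (isGradedModule_freeGrading a) LinearMap.id (single_mem_freeGrading a) e x).symm

theorem map_mem_of_mem_freeGrading (hM : IsGradedModule 𝒜 ℳ) {b : ℕ} {a : Fin b → ℤ}
    {f : (Fin b → S) →ₗ[S] M} (hf : ∀ l, f (Pi.single l 1) ∈ ℳ (a l)) {e : ℤ} {u : Fin b → S}
    (hu : u ∈ freeGrading 𝒜 a e) : f u ∈ ℳ e := by
  have : freeProj 𝒜 a e u = u := by
    ext l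
    rw [freeProj_apply, intComp_of_mem_intDegree (hu l), if_pos rfl]
  rw [← this, map_freeProj hM f hf]
  exact hM.proj_mem e _

/-- The degree `e` component of any preimage works: projecting acts coordinatewise, so it stays
inside the truncation. -/
theorem exists_homogeneous_preimage (hM : IsGradedModule 𝒜 ℳ) {b : ℕ} {a : Fin b → ℤ}
    {f : (Fin b → S) →ₗ[S] M} (hf : ∀ l, f (Pi.single l 1) ∈ ℳ (a l)) {D e : ℤ} {x : M}
    (hx : x ∈ ℳ e) (hxD : x ∈ (genLE S (freeGrading 𝒜 a) D).map f) :
    ∃ u ∈ genLE S (freeGrading 𝒜 a) D, u ∈ freeGrading 𝒜 a e ∧ f u = x := by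
  obtain ⟨u, hu, rfl⟩ := hxD
  refine ⟨freeProj 𝒜 a e u, ?_, freeProj_mem a e u, ?_⟩
  · rw [SetLike.mem_coe, mem_genLE_freeGrading] at hu
    rw [mem_genLE_freeGrading]
    intro l hl
    rw [freeProj_apply, hu l hl, map_zero]
  · rw [map_freeProj hM f hf, hM.proj_self hx]

/-- The augmentation of a graded free module carries `F_⟨≤D⟩` onto `M_⟨≤D⟩`. -/
theorem map_genLE_freeGrading (hM : IsGradedModule 𝒜 ℳ) {b : ℕ} {a : Fin b → ℤ}
    {f : (Fin b → S) →ₗ[S] M} (hf : ∀ l, f (Pi.single l 1) ∈ ℳ (a l))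
    (hsurj : Function.Surjective f) (D : ℤ) :
    (genLE S (freeGrading 𝒜 a) D).map f = genLE S ℳ D := by
  apply le_antisymm
  · rw [genLE, Submodule.map_span, Submodule.span_le]
    rintro _ ⟨u, ⟨e, he, hu⟩, rfl⟩
    exact mem_genLE_of_mem he (map_mem_of_mem_freeGrading hM hf hu)
  · rw [genLE, Submodule.span_le]
    rintro x ⟨e, he, hx⟩
    obtain ⟨u, rfl⟩ := hsurj x
    refine ⟨freeProj 𝒜 a e u, mem_genLE_of_mem he (freeProj_mem a e u), ?_⟩
    rw [map_freeProj hM f hf, hM.proj_self hx]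

end GradedModules

/-! ### Consequences of generation in degree one -/

section StandardGraded

variable {k : Type u} [Field k] {S : Type v} [CommRing S] [Algebra k S]
  {𝒜 : ℕ → Submodule k S} [GradedAlgebra 𝒜]

/-- This is `S_{n+1} = S_1 · S_n`. In a product of components of total degree `n + 1`, one factor
has positive degree and a linear form can be split off from it. -/
theorem component_succ_mem_closure (hS : IsStandardGraded 𝒜) (s : S) (n : ℕ) :
    (DirectSum.decompose 𝒜 s (n + 1) : S) ∈
      AddSubgroup.closure {x | ∃ t ∈ 𝒜 1, ∃ u ∈ 𝒜 n, x = t * u} := by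
  classical
  have hs : s ∈ Algebra.adjoin k (𝒜 1 : Set S) := by rw [hS.adjoin_degree_one]; trivial
  induction hs using Algebra.adjoin_induction generalizing n with
  | mem s hs =>
    by_cases h : n = 0
    · subst h
      rw [zero_add, DirectSum.decompose_of_mem_same 𝒜 hs]
      exact AddSubgroup.subset_closure
        ⟨s, hs, 1, SetLike.GradedOne.one_mem (A := 𝒜), (mul_one s).symm⟩
    · rw [DirectSum.decompose_of_mem_ne 𝒜 hs (by omega)]
      exact AddSubgroup.zero_mem _
  | algebraMap c =>
    rw [DirectSum.decompose_of_mem_ne 𝒜 (SetLike.algebraMap_mem_graded 𝒜 c) (by omega)]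
    exact AddSubgroup.zero_mem _
  | add s t _ _ hs ht =>
    rw [DirectSum.decompose_add, DirectSum.add_apply]
    exact AddSubgroup.add_mem _ (hs n) (ht n)
  | mul s t _ _ hs ht =>
    have key : ∀ (p q : ℕ) (x y : S), p + 1 + q = n + 1 → x ∈ AddSubgroup.closure
        {x | ∃ t ∈ 𝒜 1, ∃ u ∈ 𝒜 p, x = t * u} → y ∈ 𝒜 q →
        x * y ∈ AddSubgroup.closure {x | ∃ t ∈ 𝒜 1, ∃ u ∈ 𝒜 n, x = t * u} := by
      intro p q x y hpq hx hy
      induction hx using AddSubgroup.closure_induction with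
      | mem x hx =>
        obtain ⟨t, ht, u, hu, rfl⟩ := hx
        have : n = p + q := by omega
        subst this
        exact AddSubgroup.subset_closure
          ⟨t, ht, u * y, SetLike.GradedMul.mul_mem hu hy, mul_assoc _ _ _⟩
      | zero => rw [zero_mul]; exact AddSubgroup.zero_mem _
      | add x x' _ _ hx hx' => rw [add_mul]; exact AddSubgroup.add_mem _ hx hx'
      | neg x _ hx => rw [neg_mul]; exact AddSubgroup.neg_mem _ hx
    rw [DirectSum.decompose_mul, DirectSum.coe_mul_apply]
    refine AddSubgroup.sum_mem _ fun p hp => ?_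
    have hp := (Finset.mem_filter.1 hp).2
    obtain ⟨p, q⟩ := p
    dsimp only at hp ⊢
    cases p with
    | succ p => exact key p q _ _ hp (hs p) (SetLike.coe_mem _)
    | zero =>
      have : q = n + 1 := by omega
      subst this
      rw [mul_comm]
      exact key n 0 _ _ (by omega) (ht n) (SetLike.coe_mem _)

variable {M : Type w} [AddCommGroup M] [Module S M] {ℳ : ℤ → AddSubgroup M}

/-- Above degree `D`, every degree of `M_⟨≤D⟩` is `S₁` times the preceding one. -/
theorem mem_closure_of_mem_genLE (hS : IsStandardGraded 𝒜) (hM : IsGradedModule 𝒜 ℳ) {D e : ℤ}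
    (he : D < e) {x : M} (hx : x ∈ genLE S ℳ D) (hxe : x ∈ ℳ e) :
    x ∈ AddSubgroup.closure
      {x | ∃ s ∈ 𝒜 1, ∃ y ∈ genLE S ℳ D, y ∈ ℳ (e - 1) ∧ x = s • y} := by
  -- Pass to the projection of an element not assumed homogeneous. A generator of degree at most `D`
  -- then carries a coefficient of degree at least one, from which a linear form splits off.
  rw [← hM.proj_self hxe]
  clear hxe
  induction hx using Submodule.closure_induction with
  | zero => simp
  | add x y _ _ hx hy => rw [map_add]; exact AddSubgroup.add_mem _ hx hy
  | smul_mem s x hx =>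
    obtain ⟨e', he', hx⟩ := hx
    rw [hM.proj_smul_of_mem hx]
    obtain ⟨n, hn⟩ : ∃ n : ℕ, e - e' = (n + 1 : ℕ) := ⟨(e - e' - 1).toNat, by omega⟩
    have h := component_succ_mem_closure hS s n
    have h2 : intComp 𝒜 (e - e') s = DirectSum.decompose 𝒜 s (n + 1) := by
      rw [hn, intComp, if_pos (by omega), Int.toNat_natCast, GradedRing.proj_apply]
    rw [h2]
    generalize (DirectSum.decompose 𝒜 s (n + 1) : S) = t at h
    induction h using AddSubgroup.closure_induction with
    | mem t ht =>
      obtain ⟨t, ht, u, hu, rfl⟩ := ht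
      refine AddSubgroup.subset_closure ⟨t, ht, u • x, ?_, ?_, mul_smul _ _ _⟩
      · exact Submodule.smul_mem _ _ (mem_genLE_of_mem he' hx)
      · exact hM.smul_mem' (mem_intDegree_natCast.2 hu) hx (by push_cast at hn; omega)
    | zero => rw [zero_smul]; exact AddSubgroup.zero_mem _
    | add t t' _ _ ht ht' => rw [add_smul]; exact AddSubgroup.add_mem _ ht ht'
    | neg t _ ht => rw [neg_smul]; exact AddSubgroup.neg_mem _ ht

/-- In degrees at least `d` the submodules `M_⟨≤d⟩` and `M_⟨d⟩` agree. -/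
theorem mem_genAt_iff_mem_genLE (hS : IsStandardGraded 𝒜) (hM : IsGradedModule 𝒜 ℳ) {d e : ℤ}
    (he : d ≤ e) {x : M} (hxe : x ∈ ℳ e) : x ∈ genAt S ℳ d ↔ x ∈ genLE S ℳ d := by
  constructor
  · intro hx
    have h : (ℳ d : Set M) ⊆ {x | ∃ e ≤ d, x ∈ ℳ e} := fun y hy => ⟨d, le_rfl, hy⟩
    exact Submodule.span_mono h hx
  · obtain ⟨n, rfl⟩ : ∃ n : ℕ, e = d + n := ⟨(e - d).toNat, by omega⟩
    clear he
    induction n generalizing x with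
    | zero =>
      intro _
      exact Submodule.subset_span (by simpa using hxe)
    | succ n ih =>
      intro hx
      have := mem_closure_of_mem_genLE hS hM (by push_cast; omega) hx hxe
      refine (AddSubgroup.closure_le (K := (genAt S ℳ d).toAddSubgroup)).2 ?_ this
      rintro _ ⟨s, _, y, hy, hye, rfl⟩
      refine Submodule.smul_mem _ _ (ih ?_ hy)
      convert hye using 2
      push_cast
      ring

end StandardGraded

/-! ### `Tor` through the complex `K ⊗ M`, with `K_n ⊗ M` written as vectors over `M` -/

section Tensor

variable {k : Type u} [Field k] {S : Type v} [CommRing S] [Algebra k S]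
  {𝒜 : ℕ → Submodule k S} [GradedAlgebra 𝒜]
  {R : Type*} [AddCommGroup R] [Module S R] {ℛ : ℤ → AddSubgroup R}
  (K : MinFreeRes 𝒜 ℛ)
  {M : Type*} [AddCommGroup M] [Module S M] {ℳ : ℤ → AddSubgroup M}
  {N : Type*} [AddCommGroup N] [Module S N] {𝒩 : ℤ → AddSubgroup N}

/-- The differential `K_{n+1} ⊗ M → K_n ⊗ M`. -/
def tensorD (M : Type*) [AddCommGroup M] [Module S M] (n : ℕ) :
    (Fin (K.rank (n + 1)) → M) →ₗ[S] (Fin (K.rank n) → M) :=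
  LinearMap.pi fun l => ∑ m, K.d n (Pi.single m 1) l • LinearMap.proj m

theorem tensorD_apply (n : ℕ) (y : Fin (K.rank (n + 1)) → M) (l : Fin (K.rank n)) :
    tensorD K M n y l = ∑ m, K.d n (Pi.single m 1) l • y m := by
  simp [tensorD]

/-- The differential on a pure tensor `u ⊗ y`. -/
theorem tensorD_smul_const (n : ℕ) (u : Fin (K.rank (n + 1)) → S) (y : M) :
    tensorD K M n (fun m => u m • y) = fun l => K.d n u l • y := by
  ext l
  rw [tensorD_apply, apply_eq_sum_single (K.d n) u, Finset.sum_apply, Finset.sum_smul]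
  refine Finset.sum_congr rfl fun m _ => ?_
  rw [smul_smul, Pi.smul_apply, smul_eq_mul, mul_comm]

theorem tensorD_tensorD (n : ℕ) (y : Fin (K.rank (n + 2)) → M) :
    tensorD K M n (tensorD K M (n + 1) y) = 0 := by
  classical
  have hy : y = ∑ p, fun m => (Pi.single p (1 : S) : Fin (K.rank (n + 2)) → S) m • y p := by
    ext m
    rw [Finset.sum_apply, Finset.sum_eq_single m]
    · simp
    · intro p _ hp; simp [hp.symm]
    · simp
  rw [hy, map_sum, map_sum]
  refine Finset.sum_eq_zero fun p _ => ?_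
  rw [tensorD_smul_const, tensorD_smul_const, (K.exact_succ n).apply_apply_eq_zero]
  ext
  simp

theorem tensorD_map (f : M →ₗ[S] N) (n : ℕ) (y : Fin (K.rank (n + 1)) → M) :
    tensorD K N n (fun m => f (y m)) = fun l => f (tensorD K M n y l) := by
  ext l
  simp [tensorD_apply]

/-- Tensoring with a free module gives a direct sum of copies of `K`. -/
theorem tensorD_pi {b : ℕ} (n : ℕ) (y : Fin (K.rank (n + 1)) → Fin b → S) (j : Fin b)
    (l : Fin (K.rank n)) : tensorD K (Fin b → S) n y l j = K.d n (fun m => y m j) l := by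
  rw [tensorD_apply, apply_eq_sum_single (K.d n), Finset.sum_apply, Finset.sum_apply]
  refine Finset.sum_congr rfl fun m _ => ?_
  simp [mul_comm]

/-- The cycles of `K ⊗ M` in homological degree `i`. -/
def IsTensorCycle : ∀ i, (Fin (K.rank i) → M) → Prop
  | 0, _ => True
  | i + 1, x => tensorD K M i x = 0

/-- For a submodule `P` of `M`, every cycle of `K_i ⊗ P` with entries of degree `e` is a boundary.
If `K` is the linear resolution of the residue field, this means `Tor_i(P, k)_{i+e} = 0`. -/
def TorVanishes (ℳ : ℤ → AddSubgroup M) (P : Submodule S M) (i : ℕ) (e : ℤ) : Prop :=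
  ∀ x : Fin (K.rank i) → M, (∀ l, x l ∈ P) → (∀ l, x l ∈ ℳ e) → IsTensorCycle K i x →
    ∃ y : Fin (K.rank (i + 1)) → M,
      (∀ m, y m ∈ P) ∧ (∀ m, y m ∈ ℳ (e - 1)) ∧ tensorD K M i y = x

/-- The entries of the differential of `K` are linear forms. -/
def HasLinearEntries : Prop := ∀ n m l, K.d n (Pi.single m 1) l ∈ 𝒜 1

/-- `Tor_i(P, k)_{i+e} = 0` for `0 < i ≤ r` and `e > D`. -/
def TorLinear (ℳ : ℤ → AddSubgroup M) (P : Submodule S M) (D : ℤ) (r : ℕ) : Prop :=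
  ∀ i, 0 < i → i ≤ r → ∀ e, D < e → TorVanishes K ℳ P i e

variable {K}

theorem tensorD_mem (hM : IsGradedModule 𝒜 ℳ) (hK : HasLinearEntries K) {n : ℕ} {e e' : ℤ}
    (he : e' = e + 1) {y : Fin (K.rank (n + 1)) → M} (hy : ∀ m, y m ∈ ℳ e) (l : Fin (K.rank n)) :
    tensorD K M n y l ∈ ℳ e' := by
  rw [tensorD_apply]
  refine AddSubgroup.sum_mem _ fun m _ => hM.smul_mem' (z := (1 : ℕ)) ?_ (hy m) ?_
  · exact mem_intDegree_natCast.2 (hK n m l)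
  · push_cast; omega

theorem tensorD_mem_submodule {n : ℕ} {P : Submodule S M} {y : Fin (K.rank (n + 1)) → M}
    (hy : ∀ m, y m ∈ P) (l : Fin (K.rank n)) : tensorD K M n y l ∈ P := by
  rw [tensorD_apply]
  exact Submodule.sum_mem _ fun m _ => Submodule.smul_mem _ _ (hy m)

theorem isTensorCycle_tensorD (i : ℕ) (y : Fin (K.rank (i + 1)) → M) :
    IsTensorCycle K i (tensorD K M i y) := by
  cases i with
  | zero => trivial
  | succ i => exact tensorD_tensorD K i y

/-- A graded exact sequence `0 → C ∩ ker f → C → P → 0` gives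
`Tor_{i+1}(P) → Tor_i(C ∩ ker f) → Tor_i(C)`. -/
theorem TorVanishes.ker (hM : IsGradedModule 𝒜 ℳ) (hK : HasLinearEntries K)
    {f : M →ₗ[S] N} {C : Submodule S M}
    (hf : ∀ e, ∀ x ∈ ℳ e, f x ∈ 𝒩 e)
    (hlift : ∀ e, ∀ y ∈ 𝒩 e, y ∈ C.map f → ∃ x ∈ C, x ∈ ℳ e ∧ f x = y) {i : ℕ} {e : ℤ}
    (hP : TorVanishes K 𝒩 (C.map f) (i + 1) e) (hC : TorVanishes K ℳ C i (e + 1)) :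
    TorVanishes K ℳ (C ⊓ LinearMap.ker f) i (e + 1) := by
  intro z hzC hze hz
  obtain ⟨c, hcC, hce, rfl⟩ := hC z (fun l => (hzC l).1) hze hz
  rw [add_sub_cancel_right] at hce
  obtain ⟨p, hpP, hpe, hp⟩ := hP (fun m => f (c m)) (fun m => ⟨c m, hcC m, rfl⟩)
    (fun m => hf _ _ (hce m)) (by
      change tensorD K N i _ = 0
      rw [tensorD_map]
      ext l
      exact (hzC l).2)
  choose q hqC hqe hq using fun m => hlift _ (p m) (hpe m) (hpP m)
  -- The image of `c` is a cycle, hence the boundary of `p`, which lifts to `q`. Subtracting the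
  -- boundary of `q` pushes `c` into `ker f` without changing its own boundary.
  refine ⟨c - tensorD K M (i + 1) q, fun m => ⟨?_, ?_⟩, fun m => ?_, ?_⟩
  · exact Submodule.sub_mem _ (hcC m) (tensorD_mem_submodule hqC m)
  · have h1 := congrFun hp m
    have h2 := congrFun (tensorD_map K f (i + 1) q) m
    simp only [hq] at h2
    change f (c m - _) = 0
    rw [map_sub, ← h2, h1, sub_self]
  · rw [add_sub_cancel_right]
    exact AddSubgroup.sub_mem _ (hce m) (tensorD_mem hM hK (by ring) hqe m)
  · rw [map_sub, tensorD_tensorD, sub_zero]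

/-- A graded exact sequence `0 → C ∩ ker f → C → P → 0` gives
`Tor_{i+1}(C) → Tor_{i+1}(P) → Tor_i(C ∩ ker f)`. -/
theorem TorVanishes.map (hM : IsGradedModule 𝒜 ℳ) (hK : HasLinearEntries K)
    {f : M →ₗ[S] N} {C : Submodule S M}
    (hf : ∀ e, ∀ x ∈ ℳ e, f x ∈ 𝒩 e)
    (hlift : ∀ e, ∀ y ∈ 𝒩 e, y ∈ C.map f → ∃ x ∈ C, x ∈ ℳ e ∧ f x = y) {i : ℕ} {e : ℤ}
    (hZ : TorVanishes K ℳ (C ⊓ LinearMap.ker f) i (e + 1)) (hC : TorVanishes K ℳ C (i + 1) e) :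
    TorVanishes K 𝒩 (C.map f) (i + 1) e := by
  intro x hxP hxe hx
  choose c hcC hce hc using fun l => hlift _ (x l) (hxe l) (hxP l)
  obtain ⟨z, hzC, hze, hz⟩ := hZ (tensorD K M i c) (fun l => ⟨tensorD_mem_submodule hcC l, by
      have h := congrFun (tensorD_map K f i c) l
      simp only [hc] at h
      exact h.symm.trans (congrFun hx l)⟩)
    (fun l => tensorD_mem hM hK rfl hce l) (isTensorCycle_tensorD i c)
  -- The boundary of the lift `c` lies in `ker f` and equals that of `z`, so `c - z` is a cycle over
  -- `C` which still lifts `x`.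
  rw [add_sub_cancel_right] at hze
  obtain ⟨y, hyC, hye, hy⟩ := hC (c - z) (fun l => Submodule.sub_mem _ (hcC l) (hzC l).1)
    (fun l => AddSubgroup.sub_mem _ (hce l) (hze l)) (by
      change tensorD K M i _ = 0
      rw [map_sub, hz, sub_self])
  refine ⟨fun m => f (y m), fun m => ⟨y m, hyC m, rfl⟩, fun m => hf _ _ (hye m), ?_⟩
  rw [tensorD_map, hy]
  ext l
  rw [Pi.sub_apply, map_sub, hc, LinearMap.mem_ker.1 (hzC l).2, sub_zero]

/-- Right exactness of `Tor_0`: in homological degree zero every lift is a cycle, so no condition on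
the kernel is needed. -/
theorem TorVanishes.map_zero
    {f : M →ₗ[S] N} {C : Submodule S M}
    (hf : ∀ e, ∀ x ∈ ℳ e, f x ∈ 𝒩 e)
    (hlift : ∀ e, ∀ y ∈ 𝒩 e, y ∈ C.map f → ∃ x ∈ C, x ∈ ℳ e ∧ f x = y) {e : ℤ}
    (hC : TorVanishes K ℳ C 0 e) : TorVanishes K 𝒩 (C.map f) 0 e := by
  intro x hxP hxe _
  choose c hcC hce hc using fun l => hlift _ (x l) (hxe l) (hxP l)
  obtain ⟨y, hyC, hye, hy⟩ := hC c hcC hce trivial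
  refine ⟨fun m => f (y m), fun m => ⟨y m, hyC m, rfl⟩, fun m => hf _ _ (hye m), ?_⟩
  rw [tensorD_map, hy]
  ext l
  exact hc l

end Tensor

/-! ### Dimension shifting with the linear resolution of the residue field -/

section Koszul

variable {k : Type u} [Field k] {S : Type v} [CommRing S] [Algebra k S]
  {𝒜 : ℕ → Submodule k S} [GradedAlgebra 𝒜] {K : MinFreeRes 𝒜 (residueGrading 𝒜)} {c : ℤ}
  {M : Type*} [AddCommGroup M] [Module S M] {ℳ : ℤ → AddSubgroup M}

/-- Generators of consecutive terms differ in degree by exactly one; the shift `c` cancels. -/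
theorem hasLinearEntries_of_deg (hdeg : ∀ i l, K.deg i l = (i : ℤ) + c) : HasLinearEntries K := by
  intro n m l
  have h := K.d_homogeneous n m l
  rw [hdeg, hdeg] at h
  rw [← mem_intDegree_natCast]
  convert h using 2
  push_cast
  ring

/-- If `K_0` were zero, vanishing of `Tor_0` would carry no information; `le_of_torVanishes_zero`
reads off one coordinate. -/
theorem rank_zero_pos (hS : IsStandardGraded 𝒜) (K : MinFreeRes 𝒜 (residueGrading 𝒜)) :
    0 < K.rank 0 := by
  by_contra h
  have h0 : K.rank 0 = 0 := by omega
  obtain ⟨u, hu⟩ := K.surjective (Submodule.Quotient.mk 1)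
  have hu0 : u = 0 := by
    ext l
    exact absurd l.2 (by omega)
  rw [hu0, map_zero] at hu
  exact one_notMem_maxIdeal hS ((Submodule.Quotient.mk_eq_zero _).1 hu.symm)

/-- Above degree `D`, elements of `M_⟨≤D⟩` are sums of `s • y` with `s` a linear form. Such an `s`
kills `k`, so `s` times a basis vector of `K_0` is a boundary in `K`, and tensoring with `y` gives
the required one. -/
theorem torVanishes_genLE_zero (hS : IsStandardGraded 𝒜) (hdeg : ∀ i l, K.deg i l = (i : ℤ) + c)
    (hM : IsGradedModule 𝒜 ℳ) {D e : ℤ} (he : D < e) : TorVanishes K ℳ (genLE S ℳ D) 0 e := by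
  intro x hxD hxe _
  -- The boundaries of the required kind form a subgroup, which reduces the claim to a single
  -- coordinate of the form `s • y`.
  let B : AddSubgroup (Fin (K.rank 0) → M) :=
    { carrier := {x | ∃ y : Fin (K.rank 1) → M,
        (∀ m, y m ∈ genLE S ℳ D) ∧ (∀ m, y m ∈ ℳ (e - 1)) ∧ tensorD K M 0 y = x}
      zero_mem' := ⟨0, fun _ => Submodule.zero_mem _, fun _ => AddSubgroup.zero_mem _, map_zero _⟩
      add_mem' := by
        rintro _ _ ⟨y, h1, h2, rfl⟩ ⟨y', h1', h2', rfl⟩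
        exact ⟨y + y', fun m => Submodule.add_mem _ (h1 m) (h1' m),
          fun m => AddSubgroup.add_mem _ (h2 m) (h2' m), map_add _ _ _⟩
      neg_mem' := by
        rintro _ ⟨y, h1, h2, rfl⟩
        exact ⟨-y, fun m => Submodule.neg_mem _ (h1 m),
          fun m => AddSubgroup.neg_mem _ (h2 m), map_neg _ _⟩ }
  change x ∈ B
  rw [← Finset.univ_sum_single x]
  refine AddSubgroup.sum_mem _ fun l _ => ?_
  have h := mem_closure_of_mem_genLE hS hM he (hxD l) (hxe l)
  generalize x l = z at h
  induction h using AddSubgroup.closure_induction with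
  | zero => rw [Pi.single_zero]; exact AddSubgroup.zero_mem _
  | add z z' _ _ hz hz' => rw [Pi.single_add]; exact AddSubgroup.add_mem _ hz hz'
  | neg z _ hz => rw [Pi.single_neg]; exact AddSubgroup.neg_mem _ hz
  | mem z hz =>
    obtain ⟨s, hs, y, hyD, hye, rfl⟩ := hz
    have hker : K.ε (Pi.single l s) = 0 := by
      have h1 : (Pi.single l s : Fin (K.rank 0) → S) = s • Pi.single l 1 := by
        rw [← Pi.single_smul, smul_eq_mul, mul_one]
      rw [h1, map_smul]
      obtain ⟨t, ht⟩ := Submodule.Quotient.mk_surjective _ (K.ε (Pi.single l 1))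
      rw [← ht, ← Submodule.Quotient.mk_smul, Submodule.Quotient.mk_eq_zero, smul_eq_mul]
      exact Ideal.mul_mem_right _ _ (mem_maxIdeal_of_mem_one hs)
    obtain ⟨u, hu⟩ := (K.exact_zero _).1 hker
    have hu' : K.d 0 (freeProj 𝒜 (K.deg 1) (1 + c) u) = Pi.single l s := by
      rw [map_freeProj (isGradedModule_freeGrading (K.deg 0)) _ (K.d_homogeneous 0), hu,
        IsGradedModule.proj_self]
      have := single_mem_freeGrading_of_mem (K.deg 0) l hs
      rw [hdeg] at this
      simpa using this
    refine ⟨fun m => freeProj 𝒜 (K.deg 1) (1 + c) u m • y, fun m => Submodule.smul_mem _ _ hyD,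
      fun m => hM.smul_mem' (freeProj_mem (K.deg 1) (1 + c) u m) hye ?_, ?_⟩
    · rw [hdeg]; push_cast; ring
    · rw [tensorD_smul_const, hu']
      ext l'
      by_cases h : l' = l
      · subst h; simp
      · simp [h]

/-- The truncation is free on the basis vectors of degree at most `D`, so the complex splits into
shifted copies of `K`, exact in positive homological degrees. -/
theorem torVanishes_free_succ (hdeg : ∀ i l, K.deg i l = (i : ℤ) + c) {b : ℕ} (a : Fin b → ℤ)
    (D : ℤ) (i : ℕ) (e : ℤ) :
    TorVanishes K (freeGrading 𝒜 a) (genLE S (freeGrading 𝒜 a) D) (i + 1) e := by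
  classical
  intro x hxD hxe hx
  have hx : tensorD K (Fin b → S) i x = 0 := hx
  have key : ∀ j, ∃ u : Fin (K.rank (i + 2)) → S, (∀ m, u m ∈ intDegree 𝒜 (e - 1 - a j)) ∧
      K.d (i + 1) u = fun m => x m j := by
    intro j
    have hj : K.d i (fun m => x m j) = 0 := by
      ext l
      rw [← tensorD_pi, hx]
      rfl
    obtain ⟨u, hu⟩ := (K.exact_succ i _).1 hj
    -- The `j`-th coordinates have degree `e - a j`, and the basis of `K_{i+1}` sits in degree `i +
    -- 1 + c`.
    refine ⟨freeProj 𝒜 (K.deg (i + 2)) (e - a j + (i + 1) + c) u, fun m => ?_, ?_⟩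
    · have := freeProj_mem (𝒜 := 𝒜) (K.deg (i + 2)) (e - a j + (i + 1) + c) u m
      rw [hdeg] at this
      convert this using 2
      push_cast
      ring
    · rw [map_freeProj (isGradedModule_freeGrading (K.deg (i + 1))) _ (K.d_homogeneous (i + 1)), hu,
        IsGradedModule.proj_self]
      intro m
      have := hxe m j
      rw [hdeg]
      convert this using 2
      push_cast
      ring
  choose u hue hu using key
  -- Coordinates outside the truncation are already zero in `x`, so their preimages may be replaced
  -- by zero.
  refine ⟨fun m j => if D < a j then 0 else u j m, fun m => ?_, fun m j => ?_, ?_⟩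
  · rw [mem_genLE_freeGrading]
    exact fun j hj => if_pos hj
  · change (if D < a j then (0 : S) else u j m) ∈ intDegree 𝒜 (e - 1 - a j)
    split_ifs
    · exact Submodule.zero_mem _
    · exact hue j m
  · ext m j
    rw [tensorD_pi]
    split_ifs with h
    · have hx0 := hxD m
      rw [mem_genLE_freeGrading] at hx0
      rw [hx0 j h]
      exact congrFun (map_zero (K.d (i + 1))) m
    · exact congrFun (hu j) m

/-- If `Tor_0(P, k)` vanishes in degrees above `D`, then `P` is generated in degrees at most `D`. -/
theorem le_of_torVanishes_zero (hS : IsStandardGraded 𝒜) (hM : IsGradedModule 𝒜 ℳ)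
    {P Q : Submodule S M} {D : ℤ}
    (hP : ∀ x ∈ P, ∀ e, hM.proj e x ∈ P)
    (h0 : ∀ e, D < e → TorVanishes K ℳ P 0 e) (hQ : ∀ e ≤ D, ∀ x ∈ P, x ∈ ℳ e → x ∈ Q) : P ≤ Q := by
  have key : ∀ n : ℕ, ∀ x ∈ P, x ∈ ℳ (D + n) → x ∈ Q := by
    intro n
    induction n with
    | zero => exact fun x hx hxe => hQ D le_rfl x hx (by simpa using hxe)
    | succ n ih =>
      intro x hx hxe
      -- Apply the vanishing to the vector with every coordinate equal to `x`; one coordinate then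
      -- writes `x` as a combination of elements of `P` of degree one lower.
      obtain ⟨y, hyP, hye, hy⟩ := h0 (D + (n + 1 : ℕ)) (by push_cast; omega) (fun _ => x)
        (fun _ => hx) (fun _ => hxe) trivial
      rw [← congrFun hy ⟨0, rank_zero_pos hS K⟩, tensorD_apply]
      refine Submodule.sum_mem _ fun m _ => Submodule.smul_mem _ _ (ih _ (hyP m) ?_)
      convert hye m using 2
      push_cast
      ring
  intro x hx
  obtain ⟨s, hs⟩ := hM.exists_sum_proj x
  rw [hs]
  refine Submodule.sum_mem _ fun e _ => ?_
  by_cases he : e ≤ D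
  · exact hQ e he _ (hP x hx e) (hM.proj_mem e x)
  · obtain ⟨n, rfl⟩ : ∃ n : ℕ, e = D + n := ⟨(e - D).toNat, by omega⟩
    exact key n _ (hP x hx _) (hM.proj_mem _ x)

/-- The inductive step: for an exact sequence `F' → F → N` of homogeneous maps with `F'`, `F` free,
linearity of `Tor` for `f(F_⟨≤D⟩)` is exactness of the truncation at `F` together with linearity of
`Tor` for the truncated syzygies. -/
theorem torLinear_map_succ_iff (hS : IsStandardGraded 𝒜)
    (hdeg : ∀ i l, K.deg i l = (i : ℤ) + c) (hM : IsGradedModule 𝒜 ℳ) {b b' : ℕ}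
    {a : Fin b → ℤ} {a' : Fin b' → ℤ} {f : (Fin b → S) →ₗ[S] M}
    {g : (Fin b' → S) →ₗ[S] (Fin b → S)} (hf : ∀ l, f (Pi.single l 1) ∈ ℳ (a l))
    (hg : ∀ l, g (Pi.single l 1) ∈ freeGrading 𝒜 a (a' l)) (hfg : Function.Exact g f) {D : ℤ}
    (hmin : ∀ x ∈ genLE S (freeGrading 𝒜 a') (D + 1), g x ∈ genLE S (freeGrading 𝒜 a) D) (r : ℕ) :
    TorLinear K ℳ ((genLE S (freeGrading 𝒜 a) D).map f) D (r + 1) ↔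
      genLE S (freeGrading 𝒜 a) D ⊓ LinearMap.ker f ≤
          (genLE S (freeGrading 𝒜 a') (D + 1)).map g ∧
        TorLinear K (freeGrading 𝒜 a) ((genLE S (freeGrading 𝒜 a') (D + 1)).map g) (D + 1) r := by
  have hK := hasLinearEntries_of_deg hdeg
  have hF := isGradedModule_freeGrading (𝒜 := 𝒜) a
  have hF' := isGradedModule_freeGrading (𝒜 := 𝒜) a'
  have hf' : ∀ e, ∀ x ∈ freeGrading 𝒜 a e, f x ∈ ℳ e :=
    fun e x hx => map_mem_of_mem_freeGrading hM hf hx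
  have hg' : ∀ e, ∀ x ∈ freeGrading 𝒜 a' e, g x ∈ freeGrading 𝒜 a e :=
    fun e x hx => map_mem_of_mem_freeGrading hF hg hx
  have hlift : ∀ e, ∀ y ∈ ℳ e, y ∈ (genLE S (freeGrading 𝒜 a) D).map f →
      ∃ x ∈ genLE S (freeGrading 𝒜 a) D, x ∈ freeGrading 𝒜 a e ∧ f x = y :=
    fun e y hy hyD => exists_homogeneous_preimage hM hf hy hyD
  have hlift' : ∀ e, ∀ y ∈ freeGrading 𝒜 a e, y ∈ (genLE S (freeGrading 𝒜 a') (D + 1)).map g →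
      ∃ x ∈ genLE S (freeGrading 𝒜 a') (D + 1), x ∈ freeGrading 𝒜 a' e ∧ g x = y :=
    fun e y hy hyD => exists_homogeneous_preimage hF hg hy hyD
  -- All `Tor` of the truncated free module vanishes above `D`, so the connecting maps shift without
  -- error.
  have hC : ∀ i e, D < e → TorVanishes K (freeGrading 𝒜 a) (genLE S (freeGrading 𝒜 a) D) i e := by
    intro i e he
    cases i with
    | zero => exact torVanishes_genLE_zero hS hdeg hF he
    | succ i => exact torVanishes_free_succ hdeg a D i e
  have hle : (genLE S (freeGrading 𝒜 a') (D + 1)).map g ≤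
      genLE S (freeGrading 𝒜 a) D ⊓ LinearMap.ker f := by
    rintro _ ⟨x, hx, rfl⟩
    exact ⟨hmin x hx, hfg.apply_apply_eq_zero x⟩
  constructor
  · intro h
    have hZ : ∀ i ≤ r, ∀ e, D + 1 < e → TorVanishes K (freeGrading 𝒜 a)
        (genLE S (freeGrading 𝒜 a) D ⊓ LinearMap.ker f) i e := by
      intro i hi e he
      obtain ⟨e, rfl⟩ : ∃ e', e = e' + 1 := ⟨e - 1, by ring⟩
      exact TorVanishes.ker hF hK hf' hlift (h (i + 1) (by omega) (by omega) e (by omega))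
        (hC i _ (by omega))
    -- Vanishing of `Tor_0` bounds the generators of the truncated syzygies by `D + 1`; in those
    -- degrees exactness of `F' → F → N` gives preimages in `F'_⟨≤D+1⟩`.
    have hex : genLE S (freeGrading 𝒜 a) D ⊓ LinearMap.ker f ≤
        (genLE S (freeGrading 𝒜 a') (D + 1)).map g := by
      refine le_of_torVanishes_zero hS hF ?_ (hZ 0 (by omega)) ?_
      · rintro x ⟨hx1, hx2⟩ e
        refine ⟨proj_mem_genLE hF hx1 e, ?_⟩
        change f (hF.proj e x) = 0
        have hx2 : f x = 0 := hx2
        rw [proj_freeGrading, map_freeProj hM f hf, hx2, map_zero]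
      · rintro e he x ⟨hx1, hx2⟩ hxe
        obtain ⟨y, rfl⟩ := (hfg x).1 hx2
        refine ⟨freeProj 𝒜 a' e y, mem_genLE_of_mem he (freeProj_mem a' e y), ?_⟩
        rw [map_freeProj hF g hg, hF.proj_self hxe]
    refine ⟨hex, ?_⟩
    rw [le_antisymm hle hex]
    exact fun i _ hi e he => hZ i hi e he
  · rintro ⟨hex, h⟩ i hi hir e he
    obtain ⟨i, rfl⟩ : ∃ j, i = j + 1 := ⟨i - 1, by omega⟩
    refine TorVanishes.map hF hK hf' hlift ?_ (hC (i + 1) e he)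
    rw [← le_antisymm hle hex]
    cases i with
    -- `TorLinear` says nothing about `Tor_0`. Its vanishing comes from exactness, which makes the
    -- syzygies an image of `F'_⟨≤D+1⟩`.
    | zero =>
      exact TorVanishes.map_zero hg' hlift' (torVanishes_genLE_zero hS hdeg hF' (by omega))
    | succ i => exact h (i + 1) (by omega) (by omega) _ (by omega)

end Koszul

/-! ### Exactness for subquotients and direct sums -/

section Pieces

variable {S : Type v} [CommRing S] {M N P : Type*} [AddCommGroup M] [Module S M]
  [AddCommGroup N] [Module S N] [AddCommGroup P] [Module S P]
  {ℳ : ℤ → AddSubgroup M} {𝒩 : ℤ → AddSubgroup N} {𝒬 : ℤ → AddSubgroup P}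

/-- Lifts exactness of subquotients to elements of the filtered modules, where it can be compared
with the truncations. -/
theorem ker_pieceMap_le_range_iff {f : N →ₗ[S] P} {g : M →ₗ[S] N} {c c' : ℤ}
    (hf : ∀ D, ∀ x ∈ genLE S 𝒩 D, f x ∈ genLE S 𝒬 (D + c))
    (hg : ∀ D, ∀ x ∈ genLE S ℳ D, g x ∈ genLE S 𝒩 (D + c')) {d₀ d₁ d₂ : ℤ} (h₀ : d₀ = d₁ + c)
    (h₁ : d₁ = d₂ + c') :
    LinearMap.ker (pieceMap 𝒩 𝒬 f c hf d₁ d₀ h₀) ≤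
        LinearMap.range (pieceMap ℳ 𝒩 g c' hg d₂ d₁ h₁) ↔
      ∀ x ∈ genLE S 𝒩 d₁, f x ∈ genLE S 𝒬 (d₀ - 1) →
        ∃ y ∈ genLE S ℳ d₂, x - g y ∈ genLE S 𝒩 (d₁ - 1) := by
  constructor
  · intro h x hx hfx
    have hmem : (Submodule.Quotient.mk ⟨x, hx⟩ : Piece S 𝒩 d₁) ∈
        LinearMap.ker (pieceMap 𝒩 𝒬 f c hf d₁ d₀ h₀) :=
      (Submodule.Quotient.mk_eq_zero _).2 hfx
    obtain ⟨y, hy⟩ := h hmem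
    obtain ⟨y, rfl⟩ := Submodule.Quotient.mk_surjective _ y
    exact ⟨y, y.2,
      (Submodule.Quotient.eq ((genLE S 𝒩 (d₁ - 1)).submoduleOf (genLE S 𝒩 d₁))).1 hy.symm⟩
  · intro h x hx
    obtain ⟨x, rfl⟩ := Submodule.Quotient.mk_surjective _ x
    obtain ⟨y, hy, hxy⟩ := h x x.2 ((Submodule.Quotient.mk_eq_zero
      ((genLE S 𝒬 (d₀ - 1)).submoduleOf (genLE S 𝒬 d₀))).1 hx)
    exact ⟨Submodule.Quotient.mk ⟨y, hy⟩, ((Submodule.Quotient.eq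
      ((genLE S 𝒩 (d₁ - 1)).submoduleOf (genLE S 𝒩 d₁))).2 hxy).symm⟩

theorem pieceMap_surjective {f : M →ₗ[S] N} {c : ℤ}
    (hf : ∀ D, ∀ x ∈ genLE S ℳ D, f x ∈ genLE S 𝒩 (D + c)) {d d' : ℤ} (hd : d' = d + c)
    (h : genLE S 𝒩 d' ≤ (genLE S ℳ d).map f) :
    Function.Surjective (pieceMap ℳ 𝒩 f c hf d d' hd) := by
  intro y
  obtain ⟨y, rfl⟩ := Submodule.Quotient.mk_surjective _ y
  obtain ⟨x, hx, hxy⟩ := h y.2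
  refine ⟨Submodule.Quotient.mk ⟨x, hx⟩, ?_⟩
  exact congrArg Submodule.Quotient.mk (Subtype.ext hxy)

theorem ker_lmap_le_range_lmap_iff {ι : Type*} {A B C : ι → Type*} [∀ i, AddCommGroup (A i)]
    [∀ i, Module S (A i)] [∀ i, AddCommGroup (B i)] [∀ i, Module S (B i)]
    [∀ i, AddCommGroup (C i)] [∀ i, Module S (C i)] (f : ∀ i, B i →ₗ[S] C i)
    (g : ∀ i, A i →ₗ[S] B i) :
    LinearMap.ker (DirectSum.lmap f) ≤ LinearMap.range (DirectSum.lmap g) ↔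
      ∀ i, LinearMap.ker (f i) ≤ LinearMap.range (g i) := by
  classical
  constructor
  · intro h i x hx
    have hmem : DirectSum.lof S ι B i x ∈ LinearMap.ker (DirectSum.lmap f) := by
      rw [LinearMap.mem_ker, DirectSum.lmap_lof, LinearMap.mem_ker.1 hx, map_zero]
    obtain ⟨y, hy⟩ := h hmem
    refine ⟨y i, ?_⟩
    rw [← DirectSum.lmap_apply, hy, DirectSum.lof_apply]
  · intro h x hx
    have hxi : ∀ i, f i (x i) = 0 := fun i => by
      rw [← DirectSum.lmap_apply, LinearMap.mem_ker.1 hx]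
      rfl
    rw [← DirectSum.sum_support_of x]
    refine Submodule.sum_mem _ fun i _ => ?_
    obtain ⟨y, hy⟩ := h i (hxi i)
    refine ⟨DirectSum.of A i y, ?_⟩
    rw [DirectSum.lmap_of, hy]

end Pieces

/-! ### Truncations, strands and the homology of `lin(F)` -/

section Truncation

variable {k : Type u} [Field k] {S : Type v} [CommRing S] [Algebra k S]
  {𝒜 : ℕ → Submodule k S} [GradedAlgebra 𝒜]
  {M : Type w} [AddCommGroup M] [Module S M] {ℳ : ℤ → AddSubgroup M}

namespace MinFreeRes

/-- The term `(F_n)_⟨≤d+n⟩` of the subcomplex `F_⟨≤d⟩`. -/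
def trunc (F : MinFreeRes 𝒜 ℳ) (d : ℤ) (n : ℕ) : Submodule S (Fin (F.rank n) → S) :=
  genLE S (F.grading n) (d + n)

/-- The kernel of the map leaving `F_n` in the augmented resolution. -/
def cycles (F : MinFreeRes 𝒜 ℳ) : ∀ n, Submodule S (Fin (F.rank n) → S)
  | 0 => LinearMap.ker F.ε
  | n + 1 => LinearMap.ker (F.d n)

/-- Exactness of the complex `F_⟨≤d⟩ → M_⟨≤d⟩` in homological degree `n`. -/
def TruncExact (F : MinFreeRes 𝒜 ℳ) (d : ℤ) (n : ℕ) : Prop :=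
  F.trunc d n ⊓ F.cycles n ≤ (F.trunc d (n + 1)).map (F.d n)

/-- Exactness of the complex `F_⟨d⟩ → M_⟨≤d⟩ / M_⟨≤d-1⟩` in homological degree `n`. -/
def StrandExact (F : MinFreeRes 𝒜 ℳ) (d : ℤ) : ℕ → Prop
  | 0 => LinearMap.ker (F.strandAug d) ≤ LinearMap.range (F.strandD d 0)
  | n + 1 => LinearMap.ker (F.strandD d n) ≤ LinearMap.range (F.strandD d (n + 1))

variable (F : MinFreeRes 𝒜 ℳ)

theorem range_d (n : ℕ) : LinearMap.range (F.d n) = F.cycles n := by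
  cases n with
  | zero => exact (LinearMap.exact_iff.1 F.exact_zero).symm
  | succ n => exact (LinearMap.exact_iff.1 (F.exact_succ n)).symm

theorem map_ε_trunc (hM : IsGradedModule 𝒜 ℳ) (d : ℤ) :
    (F.trunc d 0).map F.ε = genLE S ℳ d := by
  rw [trunc, Nat.cast_zero, add_zero]
  exact map_genLE_freeGrading hM F.ε_homogeneous F.surjective d

theorem trunc_sub_one (d : ℤ) (n : ℕ) : F.trunc (d - 1) n = genLE S (F.grading n) (d + n - 1) := by
  rw [trunc]
  congr 1
  ring

theorem trunc_mono {d d' : ℤ} (h : d ≤ d') (n : ℕ) : F.trunc d n ≤ F.trunc d' n :=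
  genLE_mono (by omega)

/-- Finite rank bounds the generator degrees below; this starts the induction along the filtration.
-/
theorem exists_trunc_eq_bot (n : ℕ) : ∃ d₀, ∀ d ≤ d₀, F.trunc d n = ⊥ := by
  obtain ⟨B, hB⟩ := (Set.finite_range (F.deg n)).bddBelow
  refine ⟨B - n - 1, fun d hd => ?_⟩
  rw [eq_bot_iff]
  intro x hx
  rw [trunc, grading, mem_genLE_freeGrading] at hx
  rw [Submodule.mem_bot]
  ext l
  refine hx l ?_
  have := hB ⟨l, rfl⟩
  omega

theorem strandExact_zero_iff (d : ℤ) : F.StrandExact d 0 ↔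
    ∀ x ∈ F.trunc d 0, F.ε x ∈ genLE S ℳ (d - 1) →
      ∃ y ∈ F.trunc d 1, x - F.d 0 y ∈ F.trunc (d - 1) 0 := by
  rw [trunc_sub_one]
  exact ker_pieceMap_le_range_iff F.ε_mem_genLE (F.d_mem_genLE 0) _ _

theorem strandExact_succ_iff (d : ℤ) (n : ℕ) : F.StrandExact d (n + 1) ↔
    ∀ x ∈ F.trunc d (n + 1), F.d n x ∈ F.trunc (d - 1) n →
      ∃ y ∈ F.trunc d (n + 2), x - F.d (n + 1) y ∈ F.trunc (d - 1) (n + 1) := by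
  rw [trunc_sub_one, trunc_sub_one]
  exact ker_pieceMap_le_range_iff (F.d_mem_genLE n) (F.d_mem_genLE (n + 1)) _ _

/-- Exactness of the strand moves a cycle, modulo a boundary, one filtration step down. The
remainder is again a cycle, and the descent stops because the filtration reaches zero. -/
theorem truncExact_of_strandExact {n : ℕ} (h : ∀ d, F.StrandExact d n) (d : ℤ) :
    F.TruncExact d n := by
  have step : ∀ d, ∀ x ∈ F.trunc d n, x ∈ F.cycles n →
      ∃ y ∈ F.trunc d (n + 1), x - F.d n y ∈ F.trunc (d - 1) n := by
    intro d x hx hxc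
    cases n with
    | zero =>
      have hxc : F.ε x = 0 := hxc
      exact (F.strandExact_zero_iff d).1 (h d) x hx (hxc ▸ Submodule.zero_mem _)
    | succ n =>
      have hxc : F.d n x = 0 := hxc
      exact (F.strandExact_succ_iff d n).1 (h d) x hx (hxc ▸ Submodule.zero_mem _)
  obtain ⟨d₀, hd₀⟩ := F.exists_trunc_eq_bot n
  have key : ∀ m : ℕ, F.TruncExact (d₀ + m) n := by
    intro m
    induction m with
    | zero =>
      rintro x ⟨hx, -⟩
      rw [hd₀ _ (by simp)] at hx
      rw [(Submodule.mem_bot S).1 hx]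
      exact Submodule.zero_mem _
    | succ m ih =>
      rintro x ⟨hx, hxc⟩
      obtain ⟨y, hy, hxy⟩ := step _ x hx hxc
      have e : d₀ + ((m + 1 : ℕ) : ℤ) - 1 = d₀ + m := by push_cast; ring
      rw [e] at hxy
      obtain ⟨z, hz, hzx⟩ := ih ⟨hxy, Submodule.sub_mem _ hxc (F.range_d n ▸ ⟨y, rfl⟩)⟩
      refine ⟨y + z, Submodule.add_mem _ hy (F.trunc_mono (by push_cast; omega) _ hz), ?_⟩
      rw [map_add, hzx, add_sub_cancel]
  by_cases hd : d ≤ d₀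
  · rintro x ⟨hx, -⟩
    rw [hd₀ d hd] at hx
    rw [(Submodule.mem_bot S).1 hx]
    exact Submodule.zero_mem _
  · have := key (d - d₀).toNat
    rwa [Int.toNat_of_nonneg (by omega), add_sub_cancel] at this

/-- If `∂x` drops in filtration, exactness of the lower truncation one homological degree down (for
`n = 0`, surjectivity onto `M_⟨≤d-1⟩`) gives `x'` in the lower truncation with the same image. Then
`x - x'` is a cycle, hence `∂y`, and `x - ∂y = x'`. -/
theorem strandExact_of_truncExact (hM : IsGradedModule 𝒜 ℳ) {n : ℕ}
    (h : ∀ d, ∀ m ≤ n, F.TruncExact d m) (d : ℤ) : F.StrandExact d n := by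
  cases n with
  | zero =>
    rw [strandExact_zero_iff]
    intro x hx hεx
    rw [← F.map_ε_trunc hM] at hεx
    obtain ⟨x', hx', hxx⟩ := hεx
    obtain ⟨y, hy, hxy⟩ := h d 0 le_rfl
      ⟨Submodule.sub_mem _ hx (F.trunc_mono (by omega) 0 hx'), by
        change F.ε (x - x') = 0
        rw [map_sub, hxx, sub_self]⟩
    exact ⟨y, hy, by rwa [hxy, sub_sub_cancel]⟩
  | succ n =>
    rw [strandExact_succ_iff]
    intro x hx hdx
    obtain ⟨x', hx', hxx⟩ := h (d - 1) n (by omega) ⟨hdx, F.range_d n ▸ ⟨x, rfl⟩⟩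
    obtain ⟨y, hy, hxy⟩ := h d (n + 1) le_rfl
      ⟨Submodule.sub_mem _ hx (F.trunc_mono (by omega) _ hx'), by
        change F.d n (x - x') = 0
        rw [map_sub, hxx, sub_self]⟩
    exact ⟨y, hy, by rwa [hxy, sub_sub_cancel]⟩

theorem subsingleton_linHomology_succ_iff (n : ℕ) :
    Subsingleton (F.LinHomology (n + 1)) ↔ ∀ d, F.StrandExact d (n + 1) := by
  rw [Submodule.Quotient.subsingleton_iff, Submodule.submoduleOf_eq_top]
  exact ker_lmap_le_range_lmap_iff _ _

theorem bijective_linHomologyZeroToGr_iff (hM : IsGradedModule 𝒜 ℳ) :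
    Function.Bijective F.linHomologyZeroToGr ↔ ∀ d, F.StrandExact d 0 := by
  -- Surjectivity is automatic, since `F_⟨≤d⟩` maps onto `M_⟨≤d⟩`; only injectivity is a condition.
  have hsurj : Function.Surjective F.linHomologyZeroToGr := by
    intro y
    have h : Function.Surjective F.linAug :=
      (DirectSum.lmap_surjective _).2 fun d =>
        pieceMap_surjective F.ε_mem_genLE _ (by
          rw [← F.map_ε_trunc hM]
          exact le_rfl)
    obtain ⟨x, hx⟩ := h y
    exact ⟨Submodule.Quotient.mk ⟨x, rfl⟩, hx⟩
  have hiff : Function.Injective F.linHomologyZeroToGr ↔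
      LinearMap.ker F.linAug ≤ LinearMap.range (F.linD 0) := by
    rw [← LinearMap.ker_eq_bot, eq_bot_iff]
    constructor
    · intro h x hx
      have h1 : (Submodule.Quotient.mk ⟨x, rfl⟩ : F.LinHomology 0) ∈
          LinearMap.ker F.linHomologyZeroToGr := hx
      have h2 : (Submodule.Quotient.mk ⟨x, rfl⟩ : F.LinHomology 0) = 0 := h h1
      exact (Submodule.Quotient.mk_eq_zero
        ((LinearMap.range (F.linD 0)).submoduleOf (LinearMap.ker (F.linFrom 0)))).1 h2
    · intro h x hx
      obtain ⟨x, rfl⟩ := Submodule.Quotient.mk_surjective _ x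
      exact (Submodule.mem_bot S).2 ((Submodule.Quotient.mk_eq_zero
        ((LinearMap.range (F.linD 0)).submoduleOf (LinearMap.ker (F.linFrom 0)))).2 (h hx))
  rw [Function.Bijective, and_iff_left hsurj, hiff]
  exact ker_lmap_le_range_lmap_iff _ _

/-- The homological conditions on `lin(F)` say that the complexes `F_⟨≤d⟩ → M_⟨≤d⟩` are exact in
homological degrees below `r`. -/
theorem linHomology_iff_truncExact (hM : IsGradedModule 𝒜 ℳ) {r : ℕ} (hr : 0 < r) :
    ((∀ n, 0 < n → n < r → Subsingleton (F.LinHomology n)) ∧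
      Function.Bijective F.linHomologyZeroToGr) ↔ ∀ d, ∀ n < r, F.TruncExact d n := by
  rw [F.bijective_linHomologyZeroToGr_iff hM]
  constructor
  · rintro ⟨h, h0⟩ d n hn
    refine F.truncExact_of_strandExact ?_ d
    cases n with
    | zero => exact h0
    | succ n => exact (F.subsingleton_linHomology_succ_iff n).1 (h _ (by omega) hn)
  · intro h
    refine ⟨fun n hn hnr => ?_, F.strandExact_of_truncExact hM fun d m hm => h d m (by omega)⟩
    obtain ⟨n, rfl⟩ : ∃ m, n = m + 1 := ⟨n - 1, by omega⟩
    exact (F.subsingleton_linHomology_succ_iff n).2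
      (F.strandExact_of_truncExact hM fun d m hm => h d m (by omega))

variable {K : MinFreeRes 𝒜 (residueGrading 𝒜)} {c : ℤ}

/-- Iterates `torLinear_map_succ_iff` along `F`. Each step extracts exactness in one homological
degree and raises the degree bound by one, matching the truncation of `F_n` at `d + n`. -/
theorem torLinear_map_trunc_iff (hS : IsStandardGraded 𝒜) (hdeg : ∀ i l, K.deg i l = (i : ℤ) + c)
    (d : ℤ) (r n : ℕ) :
    TorLinear K (F.grading n) ((F.trunc d (n + 1)).map (F.d n)) (d + (n + 1 : ℕ)) r ↔
      ∀ m < r, F.TruncExact d (n + 1 + m) := by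
  induction r generalizing n with
  | zero =>
    refine iff_of_true (fun i hi hi' => by omega) (fun m hm => by omega)
  | succ r ih =>
    have e : d + ((n + 1 : ℕ) : ℤ) + 1 = d + ((n + 1 + 1 : ℕ) : ℤ) := by push_cast; ring
    have := torLinear_map_succ_iff hS hdeg (isGradedModule_freeGrading (𝒜 := 𝒜) (F.deg n))
      (F.d_homogeneous n) (F.d_homogeneous (n + 1)) (F.exact_succ n) (D := d + (n + 1 : ℕ))
      (fun x hx => by
        have := F.d_mem_genLE (n + 1) _ x hx
        rwa [add_neg_cancel_right] at this) r
    rw [e] at this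
    refine this.trans ((and_congr_right' (ih (n + 1))).trans ?_)
    constructor
    · rintro ⟨h0, h⟩ m hm
      cases m with
      | zero => exact h0
      | succ m =>
        have := h m (by omega)
        rwa [show n + 1 + 1 + m = n + 1 + (m + 1) by omega] at this
    · refine fun h => ⟨h 0 (by omega), fun m hm => ?_⟩
      rw [show n + 1 + 1 + m = n + 1 + (m + 1) by omega]
      exact h (m + 1) (by omega)

/-- Linearity of `Tor` for `M_⟨≤d⟩` is exactness of `F_⟨≤d⟩ → M_⟨≤d⟩`. -/
theorem torLinear_genLE_iff (hS : IsStandardGraded 𝒜) (hdeg : ∀ i l, K.deg i l = (i : ℤ) + c)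
    (hM : IsGradedModule 𝒜 ℳ) (d : ℤ) (r : ℕ) :
    TorLinear K ℳ (genLE S ℳ d) d r ↔ ∀ n < r, F.TruncExact d n := by
  cases r with
  | zero =>
    refine iff_of_true (fun i hi hi' => by omega) (fun m hm => by omega)
  | succ r =>
    have := torLinear_map_succ_iff hS hdeg hM F.ε_homogeneous (F.d_homogeneous 0) F.exact_zero
      (D := d) (fun x hx => by
        have := F.d_mem_genLE 0 _ x hx
        rwa [add_neg_cancel_right] at this) r
    rw [map_genLE_freeGrading hM F.ε_homogeneous F.surjective d] at this
    have h1 := F.torLinear_map_trunc_iff hS hdeg d r 0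
    have e : d = d + (0 : ℕ) := by simp
    refine this.trans ((and_congr_right' h1).trans ?_)
    have h2 : genLE S (freeGrading 𝒜 (F.deg 0)) d ⊓ LinearMap.ker F.ε ≤
        (genLE S (freeGrading 𝒜 (F.deg 1)) (d + 1)).map (F.d 0) ↔ F.TruncExact d 0 := by
      rw [TruncExact, trunc, Nat.cast_zero, add_zero]
      rfl
    rw [h2]
    constructor
    · rintro ⟨h0, h⟩ m hm
      cases m with
      | zero => exact h0
      | succ m =>
        have := h m (by omega)
        rwa [show 0 + 1 + m = m + 1 by omega] at this
    · refine fun h => ⟨h 0 (by omega), fun m hm => ?_⟩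
      rw [show 0 + 1 + m = m + 1 by omega]
      exact h (m + 1) (by omega)

end MinFreeRes

end Truncation

/-! ### Existence of minimal graded free resolutions -/

section Existence

variable {k : Type u} [Field k] {S : Type v} [CommRing S] [Algebra k S]
  {𝒜 : ℕ → Submodule k S} [GradedAlgebra 𝒜]
  {M : Type w} [AddCommGroup M] [Module S M] {ℳ : ℤ → AddSubgroup M}

theorem IsStandardGraded.isNoetherianRing (hS : IsStandardGraded 𝒜) : IsNoetherianRing S := by
  have := hS.finite_degree_one
  obtain ⟨t, ht⟩ := (Module.Finite.iff_fg (N := 𝒜 1)).1 this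
  have : Algebra.FiniteType k S := ⟨⟨t, by
    rw [← Algebra.adjoin_span, ht, hS.adjoin_degree_one]⟩⟩
  exact Algebra.FiniteType.isNoetherianRing k S

/-- The homogeneous components of finitely many generators still generate. -/
theorem exists_homogeneous_cover (hM : IsGradedModule 𝒜 ℳ) [Module.Finite S M] :
    ∃ (b : ℕ) (a : Fin b → ℤ) (f : (Fin b → S) →ₗ[S] M),
      (∀ l, f (Pi.single l 1) ∈ ℳ (a l)) ∧ Function.Surjective f := by
  classical
  obtain ⟨T, hT⟩ := Module.Finite.fg_top (R := S) (M := M)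
  choose s hs using hM.exists_sum_proj
  let T' : Finset M := T.biUnion fun t => (s t).image fun e => hM.proj e t
  have hhom : ∀ x ∈ T', ∃ e, x ∈ ℳ e := by
    intro x hx
    obtain ⟨t, -, hx⟩ := Finset.mem_biUnion.1 hx
    obtain ⟨e, -, rfl⟩ := Finset.mem_image.1 hx
    exact ⟨e, hM.proj_mem e t⟩
  let g : Fin T'.card → M := fun l => T'.equivFin.symm l
  choose a ha using fun l : Fin T'.card => hhom _ (T'.equivFin.symm l).2
  refine ⟨T'.card, a, Fintype.linearCombination S g, fun l => ?_, ?_⟩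
  · rw [Fintype.linearCombination_apply_single, one_smul]
    exact ha l
  · rw [← LinearMap.range_eq_top, Fintype.range_linearCombination, eq_top_iff, ← hT,
      Submodule.span_le]
    intro t ht
    rw [hs t]
    refine Submodule.sum_mem _ fun e he => Submodule.subset_span ?_
    have hmem : hM.proj e t ∈ T' :=
      Finset.mem_biUnion.2 ⟨t, ht, Finset.mem_image.2 ⟨e, he, rfl⟩⟩
    exact ⟨T'.equivFin ⟨_, hmem⟩, by simp [g]⟩

/-- A finitely generated graded module has a minimal homogeneous free cover. -/
theorem exists_minimal_cover (hS : IsStandardGraded 𝒜) (hM : IsGradedModule 𝒜 ℳ)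
    [Module.Finite S M] :
    ∃ (b : ℕ) (a : Fin b → ℤ) (f : (Fin b → S) →ₗ[S] M),
      (∀ l, f (Pi.single l 1) ∈ ℳ (a l)) ∧ Function.Surjective f ∧
        ∀ x, f x = 0 → ∀ l, x l ∈ maxIdeal 𝒜 := by
  classical
  -- Choose a homogeneous cover of least rank. A relation with a coordinate outside `𝔪` would make a
  -- generator redundant.
  have hex := exists_homogeneous_cover hM
  obtain ⟨a, f, hf, hsurj⟩ := Nat.find_spec hex
  have hmin := fun m => Nat.find_min hex (m := m)
  generalize Nat.find hex = b at a f hf hsurj hmin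
  refine ⟨b, a, f, hf, hsurj, fun x hx l => ?_⟩
  by_contra hl
  obtain ⟨b, rfl⟩ : ∃ b', b = b' + 1 := ⟨b - 1, by have := l.2; omega⟩
  rw [← intComp_zero_eq_zero_iff] at hl
  have hmem : intComp 𝒜 0 (x l) ∈ 𝒜 0 := mem_intDegree_natCast.1 (intComp_mem 0 (x l))
  rw [hS.degree_zero] at hmem
  obtain ⟨t, ht⟩ := Submodule.mem_one.1 hmem
  have ht0 : t ≠ 0 := by
    rintro rfl
    exact hl (by rw [← ht, map_zero])
  -- The component of the relation in the degree of the `l`-th generator is again a relation, and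
  -- its `l`-th coordinate is the nonzero scalar `t`, because `S_0 = k`.
  let y := freeProj 𝒜 a (a l) x
  have hy : f y = 0 := by rw [map_freeProj hM f hf, hx, map_zero]
  have hyl : y l = algebraMap k S t := by
    change intComp 𝒜 (a l - a l) (x l) = _
    rw [ht, sub_self]
  refine hmin b (by omega) ⟨fun j => a (l.succAbove j),
    Fintype.linearCombination S fun j => f (Pi.single (l.succAbove j) 1), fun j => ?_, fun z => ?_⟩
  · rw [Fintype.linearCombination_apply_single, one_smul]
    exact hf _
  · obtain ⟨u, rfl⟩ := hsurj z
    let u' := u - (u l * algebraMap k S t⁻¹) • y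
    have hu' : u' l = 0 := by
      change u l - u l * algebraMap k S t⁻¹ * y l = 0
      rw [hyl, mul_assoc, ← map_mul, inv_mul_cancel₀ ht0, map_one, mul_one, sub_self]
    refine ⟨fun j => u' (l.succAbove j), ?_⟩
    have h1 : f u' = f u := by rw [map_sub, map_smul, hy, smul_zero, sub_zero]
    rw [← h1, apply_eq_sum_single f u', Fin.sum_univ_succAbove _ l, hu', zero_smul, zero_add,
      Fintype.linearCombination_apply]

/-- A graded free module together with a graded submodule of `𝔪` times it, to be resolved. -/
structure SyzygyStage (𝒜 : ℕ → Submodule k S) [GradedAlgebra 𝒜] where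
  rank : ℕ
  deg : Fin rank → ℤ
  syz : Submodule S (Fin rank → S)
  freeProj_mem : ∀ x ∈ syz, ∀ e, freeProj 𝒜 deg e x ∈ syz
  mem_maxIdeal : ∀ x ∈ syz, ∀ l, x l ∈ maxIdeal 𝒜

theorem exists_syzygyStage (hS : IsStandardGraded 𝒜) (hM : IsGradedModule 𝒜 ℳ)
    [Module.Finite S M] :
    ∃ (s : SyzygyStage 𝒜) (f : (Fin s.rank → S) →ₗ[S] M),
      (∀ l, f (Pi.single l 1) ∈ ℳ (s.deg l)) ∧ Function.Surjective f ∧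
        LinearMap.ker f = s.syz := by
  obtain ⟨b, a, f, hf, hsurj, hmin⟩ := exists_minimal_cover hS hM
  exact ⟨⟨b, a, LinearMap.ker f, fun x hx e => by
    rw [LinearMap.mem_ker, map_freeProj hM f hf, LinearMap.mem_ker.1 hx, map_zero], hmin⟩,
    f, hf, hsurj, rfl⟩

/-- Noetherianity makes the syzygies finitely generated, so they have a minimal cover of their own.
-/
theorem SyzygyStage.exists_next (hS : IsStandardGraded 𝒜) (s : SyzygyStage 𝒜) :
    ∃ (t : SyzygyStage 𝒜) (f : (Fin t.rank → S) →ₗ[S] (Fin s.rank → S)),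
      (∀ l, f (Pi.single l 1) ∈ freeGrading 𝒜 s.deg (t.deg l)) ∧ LinearMap.range f = s.syz ∧
        LinearMap.ker f = t.syz := by
  have := hS.isNoetherianRing
  have hN : IsGradedModule 𝒜 (subGrading (freeGrading 𝒜 s.deg) s.syz) :=
    isGradedModule_subGrading (isGradedModule_freeGrading s.deg) fun x hx e => by
      rw [proj_freeGrading]
      exact s.freeProj_mem x hx e
  obtain ⟨t, f, hf, hsurj, hker⟩ := exists_syzygyStage hS hN
  refine ⟨t, s.syz.subtype ∘ₗ f, hf, ?_, ?_⟩
  · rw [LinearMap.range_comp, LinearMap.range_eq_top.2 hsurj, Submodule.map_top,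
      Submodule.range_subtype]
  · rw [LinearMap.ker_comp, Submodule.ker_subtype, ← hker]
    rfl

/-- Finitely generated graded modules over a standard graded algebra have minimal graded free
resolutions. -/
theorem nonempty_minFreeRes (hS : IsStandardGraded 𝒜) (hM : IsGradedModule 𝒜 ℳ)
    [Module.Finite S M] : Nonempty (MinFreeRes 𝒜 ℳ) := by
  obtain ⟨s₀, ε, hε, hsurj, hker⟩ := exists_syzygyStage hS hM
  choose next f hf hrange hkerf using SyzygyStage.exists_next (𝒜 := 𝒜) hS
  let s : ℕ → SyzygyStage 𝒜 := fun n => Nat.rec s₀ (fun _ t => next t) n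
  exact ⟨{
    rank := fun n => (s n).rank
    deg := fun n => (s n).deg
    d := fun n => f (s n)
    ε := ε
    d_homogeneous := fun n => hf (s n)
    ε_homogeneous := hε
    minimal := fun n x => (s n).mem_maxIdeal _ (hrange (s n) ▸ ⟨x, rfl⟩)
    exact_succ := fun n => LinearMap.exact_iff.2 ((hkerf (s n)).trans (hrange (s (n + 1))).symm)
    exact_zero := LinearMap.exact_iff.2 (hker.trans (hrange s₀).symm)
    surjective := hsurj }⟩

end Existence

/-! ### Generator degrees of minimal resolutions and comparison of `M_⟨d⟩` with `M_⟨≤d⟩` -/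

section Degrees

variable {k : Type u} [Field k] {S : Type v} [CommRing S] [Algebra k S]
  {𝒜 : ℕ → Submodule k S} [GradedAlgebra 𝒜]
  {M : Type w} [AddCommGroup M] [Module S M] {ℳ : ℤ → AddSubgroup M}

namespace MinFreeRes

variable (F : MinFreeRes 𝒜 ℳ)

theorem mem_maxIdeal_of_mem_cycles {n : ℕ} {x : Fin (F.rank n) → S} (hx : x ∈ F.cycles n)
    (l : Fin (F.rank n)) : x l ∈ maxIdeal 𝒜 := by
  rw [← F.range_d] at hx
  obtain ⟨y, rfl⟩ := hx
  exact F.minimal n y l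

/-- By minimality cycles have all coordinates in `𝔪`, whereas here the `l`-th coordinate is `1`. -/
theorem single_sub_notMem_cycles (hS : IsStandardGraded 𝒜) {n : ℕ} {l : Fin (F.rank n)}
    {y : Fin (F.rank n) → S} (hy : y l = 0) : Pi.single l 1 - y ∉ F.cycles n := by
  intro h
  have := F.mem_maxIdeal_of_mem_cycles h l
  rw [Pi.sub_apply, hy, sub_zero, Pi.single_eq_same] at this
  exact one_notMem_maxIdeal hS this

theorem trunc_eq_top_iff (hS : IsStandardGraded 𝒜) (d : ℤ) (n : ℕ) :
    F.trunc d n = ⊤ ↔ ∀ l, F.deg n l ≤ d + n := by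
  rw [eq_top_iff]
  constructor
  · intro h l
    by_contra hl
    have h1 := h (Submodule.mem_top (x := (Pi.single l 1 : Fin (F.rank n) → S)))
    rw [trunc, grading, mem_genLE_freeGrading] at h1
    have h2 := h1 l (by omega)
    have := hS.nontrivial
    simp at h2
  · intro h x _
    rw [trunc, grading, mem_genLE_freeGrading]
    intro l hl
    have := h l
    omega

theorem deg_le_of_sub_mem_cycles (hS : IsStandardGraded 𝒜) {d : ℤ} {n : ℕ} {l : Fin (F.rank n)}
    {y : Fin (F.rank n) → S} (hy : y ∈ F.trunc d n) (h : Pi.single l 1 - y ∈ F.cycles n) :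
    F.deg n l ≤ d + n := by
  by_contra hl
  rw [trunc, grading, mem_genLE_freeGrading] at hy
  exact F.single_sub_notMem_cycles hS (hy l (by omega)) h

/-- If `M` lives in degrees at least `d`, then `F_n` is generated in degrees at least `n + d`. -/
theorem le_deg (hS : IsStandardGraded 𝒜) {d : ℤ} (hd : ∀ e < d, ∀ x ∈ ℳ e, x = 0) (n : ℕ)
    (l : Fin (F.rank n)) : d + n ≤ F.deg n l := by
  induction n with
  | zero =>
    by_contra hl
    refine F.single_sub_notMem_cycles hS (l := l) (y := 0) rfl ?_
    rw [sub_zero]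
    exact hd _ (by simpa using hl) _ (F.ε_homogeneous l)
  | succ n ih =>
    by_contra hl
    refine F.single_sub_notMem_cycles hS (l := l) (y := 0) rfl ?_
    rw [sub_zero]
    -- A generator of too small degree would map into the part of `F_n` generated below degree `d +
    -- n`, which is zero by induction; it would then be a cycle.
    have h := F.d_mem_genLE n (F.deg (n + 1) l) _
      (mem_genLE_of_mem le_rfl (single_mem_freeGrading (F.deg (n + 1)) l))
    rw [grading, mem_genLE_freeGrading] at h
    refine LinearMap.mem_ker.2 (funext fun l' => h l' ?_)
    have := ih l'
    push_cast at hl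
    omega

/-- A module generated in degree `d` satisfies `N_{d,r+1}` if and only if the complex
`F_⟨≤d⟩ → M` is exact in homological degrees below `r`. -/
theorem deg_eq_iff_truncExact (hS : IsStandardGraded 𝒜) (hM : IsGradedModule 𝒜 ℳ) {d : ℤ}
    (hd : ∀ e < d, ∀ x ∈ ℳ e, x = 0) (hgen : genLE S ℳ d = ⊤) (r : ℕ) :
    (∀ i < r + 1, ∀ l, F.deg i l = (i : ℤ) + d) ↔ ∀ n < r, F.TruncExact d n := by
  constructor
  · intro h n hn
    have htop : F.trunc d (n + 1) = ⊤ := (F.trunc_eq_top_iff hS d _).2 fun l => by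
      rw [h (n + 1) (by omega) l, add_comm]
    rw [TruncExact, htop, Submodule.map_top, F.range_d]
    exact inf_le_right
  · intro h
    have htop : ∀ i < r + 1, F.trunc d i = ⊤ := by
      intro i
      induction i with
      | zero =>
        intro _
        refine (F.trunc_eq_top_iff hS d _).2 fun l => ?_
        have h0 : F.ε (Pi.single l 1) ∈ (F.trunc d 0).map F.ε := by
          rw [F.map_ε_trunc hM, hgen]
          trivial
        obtain ⟨y, hy, hyl⟩ := h0
        refine F.deg_le_of_sub_mem_cycles hS hy ?_
        change F.ε _ = 0
        rw [map_sub, hyl, sub_self]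
      | succ i ih =>
        intro hi
        refine (F.trunc_eq_top_iff hS d _).2 fun l => ?_
        have h1 := h i (by omega)
        rw [TruncExact, ih (by omega), top_inf_eq] at h1
        -- Exactness gives a truncated `y` with the same differential as the basis vector. Their
        -- difference is a cycle, so minimality forces the basis vector into the truncation.
        obtain ⟨y, hy, hyl⟩ := h1 (F.range_d i ▸ LinearMap.mem_range_self (F.d i) (Pi.single l 1))
        refine F.deg_le_of_sub_mem_cycles hS hy ?_
        change F.d i _ = 0
        rw [map_sub, hyl, sub_self]
    intro i hi l
    have h1 := (F.trunc_eq_top_iff hS d i).1 (htop i hi) l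
    have h2 := F.le_deg hS hd i l
    omega

end MinFreeRes

theorem eq_zero_of_mem_genAt_of_lt (hM : IsGradedModule 𝒜 ℳ) {d e : ℤ} (he : e < d) {x : M}
    (hx : x ∈ genAt S ℳ d) (hxe : x ∈ ℳ e) : x = 0 := by
  rw [← hM.proj_self hxe]
  clear hxe
  induction hx using Submodule.closure_induction with
  | zero => simp
  | add x y _ _ hx hy => rw [map_add, hx, hy, add_zero]
  | smul_mem s x hx =>
    rw [hM.proj_smul_of_mem hx, intComp, if_neg (by omega), AddMonoidHom.zero_apply, zero_smul]

theorem genAt_subGrading_genAt (d : ℤ) :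
    genAt S (subGrading ℳ (genAt S ℳ d)) d = ⊤ := by
  apply Submodule.map_injective_of_injective (genAt S ℳ d).injective_subtype
  rw [Submodule.map_top, Submodule.range_subtype]
  change Submodule.map _ (Submodule.span S _) = Submodule.span S (ℳ d : Set M)
  rw [Submodule.map_span]
  congr 1
  ext x
  constructor
  · rintro ⟨y, hy, rfl⟩
    exact hy
  · intro hx
    exact ⟨⟨x, Submodule.subset_span hx⟩, hx, rfl⟩

theorem genLE_subGrading_genAt (d : ℤ) :
    genLE S (subGrading ℳ (genAt S ℳ d)) d = ⊤ := by
  rw [eq_top_iff, ← genAt_subGrading_genAt, genAt, genLE]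
  exact Submodule.span_mono fun x hx => ⟨d, le_rfl, hx⟩

theorem isTensorCycle_subtype_iff {R : Type*} [AddCommGroup R] [Module S R]
    {ℛ : ℤ → AddSubgroup R} (K : MinFreeRes 𝒜 ℛ) {N : Submodule S M} (i : ℕ)
    (x : Fin (K.rank i) → N) :
    IsTensorCycle K i (fun l => (x l : M)) ↔ IsTensorCycle K i x := by
  cases i with
  | zero => exact Iff.rfl
  | succ i =>
    change tensorD K M i (fun l => N.subtype (x l)) = 0 ↔ tensorD K N i x = 0
    rw [tensorD_map]
    simp [funext_iff]

/-- `Tor` of `M_⟨d⟩` and of `M_⟨≤d⟩` have the same components of internal degree above `d`. -/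
theorem torVanishes_subGrading_iff {R : Type*} [AddCommGroup R] [Module S R]
    {ℛ : ℤ → AddSubgroup R} (K : MinFreeRes 𝒜 ℛ) (hS : IsStandardGraded 𝒜)
    (hM : IsGradedModule 𝒜 ℳ) {d e : ℤ} (he : d < e) (i : ℕ) :
    TorVanishes K (subGrading ℳ (genAt S ℳ d)) ⊤ i e ↔ TorVanishes K ℳ (genLE S ℳ d) i e := by
  constructor
  · intro h x hx hxe hc
    have hx' := fun l => (mem_genAt_iff_mem_genLE hS hM he.le (hxe l)).2 (hx l)
    obtain ⟨y, -, hye, hy⟩ := h (fun l => ⟨x l, hx' l⟩) (fun _ => trivial) hxe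
      ((isTensorCycle_subtype_iff K i _).1 hc)
    -- Only entries of degrees `e` and `e - 1` matter. Both are at least `d` because `d < e`, and
    -- there the two submodules coincide.
    refine ⟨fun m => y m,
      fun m => (mem_genAt_iff_mem_genLE hS hM (by omega) (hye m)).1 (y m).2, hye, ?_⟩
    have := tensorD_map K (genAt S ℳ d).subtype i y
    rw [hy] at this
    exact this
  · intro h x _ hxe hc
    obtain ⟨y, hyd, hye, hy⟩ := h (fun l => x l)
      (fun l => (mem_genAt_iff_mem_genLE hS hM he.le (hxe l)).1 (x l).2) hxe
      ((isTensorCycle_subtype_iff K i _).2 hc)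
    have hy' := fun m => (mem_genAt_iff_mem_genLE hS hM (by omega) (hye m)).2 (hyd m)
    refine ⟨fun m => ⟨y m, hy' m⟩, fun _ => trivial, hye, ?_⟩
    have := tensorD_map K (genAt S ℳ d).subtype i (fun m => ⟨y m, hy' m⟩)
    ext l
    exact (congrFun this l).symm.trans (congrFun hy l)

/-- The `Tor` criterion holds for every minimal resolution `G` of `M_⟨d⟩`, so no uniqueness of
resolutions is needed; existence enters only to produce some `G` in the converse. -/
theorem satisfiesN_iff_torLinear (hS : IsStandardGraded 𝒜) {K : MinFreeRes 𝒜 (residueGrading 𝒜)}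
    {c : ℤ} (hdeg : ∀ i l, K.deg i l = (i : ℤ) + c) (hM : IsGradedModule 𝒜 ℳ)
    [Module.Finite S M] (d : ℤ) (r : ℕ) :
    SatisfiesN 𝒜 (subGrading ℳ (genAt S ℳ d)) d (r + 1) ↔ TorLinear K ℳ (genLE S ℳ d) d r := by
  have hN : IsGradedModule 𝒜 (subGrading ℳ (genAt S ℳ d)) :=
    isGradedModule_subGrading hM fun x hx e => proj_mem_genAt hM hx e
  have hlow : ∀ e < d, ∀ x ∈ subGrading ℳ (genAt S ℳ d) e, x = 0 := fun e he x hx =>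
    Subtype.ext (eq_zero_of_mem_genAt_of_lt hM he x.2 hx)
  have hTor : TorLinear K (subGrading ℳ (genAt S ℳ d)) ⊤ d r ↔
      TorLinear K ℳ (genLE S ℳ d) d r :=
    forall_congr' fun i => forall₂_congr fun _ _ => forall₂_congr fun e he =>
      torVanishes_subGrading_iff K hS hM he i
  have key : ∀ G : MinFreeRes 𝒜 (subGrading ℳ (genAt S ℳ d)),
      (∀ i < r + 1, ∀ l, G.deg i l = (i : ℤ) + d) ↔ TorLinear K ℳ (genLE S ℳ d) d r := by
    intro G
    rw [G.deg_eq_iff_truncExact hS hN hlow (genLE_subGrading_genAt d),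
      ← G.torLinear_genLE_iff hS hdeg hN, genLE_subGrading_genAt, hTor]
  constructor
  · rintro ⟨-, G, hG⟩
    exact (key G).1 hG
  · intro h
    have := hS.isNoetherianRing
    obtain ⟨G⟩ := nonempty_minFreeRes hS hN
    exact ⟨genAt_subGrading_genAt d, G, (key G).2 h⟩

end Degrees

end GradedLin

end

theorem theorem6p1 {k : Type*} [Field k] {S : Type*} [CommRing S] [Algebra k S]
    (𝒜 : ℕ → Submodule k S) [GradedAlgebra 𝒜] (hS : GradedLin.IsStandardGraded 𝒜)
    (hK : GradedLin.IsKoszul 𝒜)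
    {M : Type*} [AddCommGroup M] [Module S M] [Module.Finite S M]
    (ℳ : ℤ → AddSubgroup M) (hM : GradedLin.IsGradedModule 𝒜 ℳ)
    (F : GradedLin.MinFreeRes 𝒜 ℳ) (r : ℕ) (hr : 0 < r) :
    GradedLin.IsComponentwiseLinearUpTo 𝒜 ℳ (r + 1) ↔
      (∀ n, 0 < n → n < r → Subsingleton (F.LinHomology n)) ∧
        Function.Bijective F.linHomologyZeroToGr := by
  obtain ⟨c, K, hdeg⟩ := hK
  rw [F.linHomology_iff_truncExact hM hr]
  exact forall_congr' fun d => (GradedLin.satisfiesN_iff_torLinear hS hdeg hM d r).trans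
    (F.torLinear_genLE_iff hS hdeg hM d r)
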